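/- **Setting.** A *self-similar curve* $F\subset\mathbb R^2$ is given by a generator, that is a broken line with nodes $p_0,\dots,p_m$, and by contracting similarities $\varphi_1,\dots,\varphi_m$ of the plane with $\varphi_i(\{p_0,p_m\})=\{p_{i-1},p_i\}$; $F$ is the nonempty compact set with $F=\bigcup_i\varphi_i(F)$. *Step $j$* of its generation consists of the segments $\varphi_{i_1}\circ\dots\circ\varphi_{i_j}([p_0,p_m])$. Let $\mathsf S$ be a bounded open polygon whose boundary is a Jordan curve with sides $\sigma_1,\dots,\sigma_M$ (consecutive sides may be collinear). For a vertex $A$ with inner angle $\beta(A)\in(0,2\pi)$ and $\varepsilon>0$, let $A^{\mathrm i}_\varepsilon$ and $A^{\mathrm o}_\varepsilon$ be the points at distance $\varepsilon/\sin\frac{\beta(A)}2$ from $A$ on the bisectors of the inner and of the outer angle at $A$. For a side $\sigma_k=[A,B]$ let $\mathsf Q^k_\varepsilon(\mathsf S)$ be the open quadrilateral (the interior of the convex hull) with vertices $A^{\mathrm i}_\varepsilon,A^{\mathrm o}_\varepsilon,B^{\mathrm i}_\varepsilon,B^{\mathrm o}_\varepsilon$. Put $$[\mathsf S]^{\mathrm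 i}_\varepsilon=\mathsf S\setminus\bigcup_k\overline{\mathsf Q^k_\varepsilon},\qquad [\mathsf S]^{\mathrm o}_\varepsilon=\mathsf S\cup\operatorname{int}\Big(\bigcup_k\overline{\mathsf Q^k_\varepsilon}\Big),\qquad \beta_{\mathrm m}(\mathsf S)=\max_A\max\{\beta(A),2\pi-\beta(A)\}.$$ **Hypothesis G.** $\Sigma\subset\mathbb R^2$ is a bounded region (open, connected, nonempty) whose boundary $\partial\Sigma=\bigcup_{n=1}^NF_n$ is a Jordan curve, where the $F_n$ are self-similar curves. For each $j\ge0$, $\Sigma_j$ is a bounded open connected polygon whose boundary is a Jordan curve and whose sides are the segments of step $j$ of $F_1,\dots,F_N$. All sides of $\Sigma_j$ have the same length $\ell_j$, with $\ell_{j+1}<\ell_j$ and $\ell_j\to0$, and $\beta_{\mathrm m}(\Sigma_j)\le\beta_0$ for some $\beta_0\in(\pi,2\pi)$ and all $j$. There is $\delta>0$ such that, with $\mathsf T_j=[\Sigma_j]^{\mathrm i}_{\delta\ell_j}$ and $\mathsf H_j=[\Sigma_j]^{\mathrm o}_{\delta\ell_j}$, for all $j$: - (G1) $\mathsf Q^m_{\delta\ell_j}(\Sigma_j)\cap\mathsf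 Q^n_{\delta\ell_j}(\Sigma_j)=\varnothing$ for $m\ne n$; - (G2) $\mathsf T_j$ and $\mathsf H_j$ are simply connected; - (G3) $\mathsf H_{j+1}\setminus\mathsf T_{j+1}\subset\mathsf H_j\setminus\mathsf T_j$; - (G4) $\bigcap_j\mathsf T_j\ne\varnothing$. **Lemma.** If $\Sigma$ satisfies Hypothesis G, then it satisfies Assumption A with these $\mathsf T_j$, $\mathsf H_j$. That is, $\Sigma$ is open and simply connected, $\mathsf T_j$ and $\mathsf H_j$ are bounded open simply connected polygons, and - (A1) $\mathsf T_j\subset\mathsf T_{j+1}\subset\Sigma\subset\mathsf H_{j+1}\subset\mathsf H_j$ for all $j\ge0$; - (A2) for every $\varepsilon>0$ there is $k$ such that $\{z\in\mathsf H_j:\operatorname{dist}(z,\partial\mathsf H_j)\ge\varepsilon\}\subset\mathsf T_j$ for all $j\ge k$; - (A3) $\partial\Sigma=\bigcup_{n=1}^NF_n$ with self-similar curves $F_n$; - (A4) the vertices of $\mathsf T_j$ and $\mathsf H_j$ are obtained explicitly from the similarities: $\partial\mathsf T_j$ (respectively $\partial\mathsf H_j$) is a finite union of segments (possibly degenerate)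 whose end points are among those points $A^{\mathrm i}_{\delta\ell_j},A^{\mathrm o}_{\delta\ell_j}$, $A$ a vertex of $\Sigma_j$, that lie inside $\Sigma_j$ (respectively outside $\Sigma_j$), and the vertices of $\Sigma_j$ are exactly the images of the end points of the initial segments $[p_0,p_m]$ of the $F_n$ under the $j$-fold compositions of their similarities. -/

import Mathlib

open Set

noncomputable section

/-! The Euclidean plane is `ℂ`. -/

/-- `J` is a Jordan curve: the image of a circle under a continuous injective map. -/
def IsJordanCurve (J : Set ℂ) : Prop :=
  ∃ γ : Circle → ℂ, Continuous γ ∧ Function.Injective γ ∧ range γ = J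

/-- `U` is a bounded plane region (a nonempty connected open set) with boundary `J`. -/
structure IsBoundedRegion (U J : Set ℂ) : Prop where
  isOpen : IsOpen U
  isConnected : IsConnected U
  isBounded : Bornology.IsBounded U
  frontier_eq : frontier U = J

/-- A self-similar curve given by a generator. The generator is the broken line with the nodes
`node 0, ..., node m`; the initiator is the segment from `node 0` to `node m`. For each piece of
the generator there is a contracting similarity of the plane (possibly reversing orientation)
carrying the ends of the initiator to the ends of that piece, in either order. The curve is
the attractor of these similarities, the nonempty compact set that is the union of its images. -/
structure SelfSimilarCurve where
  m : ℕ
  node : Fin (m + 1) → ℂ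
  map : Fin m → ℂ → ℂ
  ratio : Fin m → ℝ
  ratio_pos : ∀ i, 0 < ratio i
  ratio_lt_one : ∀ i, ratio i < 1
  dist_map : ∀ i x y, dist (map i x) (map i y) = ratio i * dist x y
  map_ends : ∀ i, map i '' {node 0, node (Fin.last m)} = {node i.castSucc, node i.succ}
  carrier : Set ℂ
  isCompact : IsCompact carrier
  nonempty : carrier.Nonempty
  eq_iUnion_map : carrier = ⋃ i, map i '' carrier

namespace SelfSimilarCurve

/-- The segments that make up step `j` of the generation of the curve: the images of the
initiator under the `j`-fold compositions of the similarities. -/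
def stepSides (F : SelfSimilarCurve) : ℕ → Set (Set ℂ)
  | 0 => {segment ℝ (F.node 0) (F.node (Fin.last F.m))}
  | j + 1 => ⋃ i, (fun s => F.map i '' s) '' F.stepSides j

/-- The end points of the segments of step `j`: the images of the two end points of the initiator
under the `j`-fold compositions of the similarities. -/
def stepNodes (F : SelfSimilarCurve) : ℕ → Set ℂ
  | 0 => {F.node 0, F.node (Fin.last F.m)}
  | j + 1 => ⋃ i, F.map i '' F.stepNodes j

end SelfSimilarCurve

namespace Polygon

variable {n : ℕ}

/-- The closed broken line `P` is a Jordan curve, passed once: there are at least three sides,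
the sides are nondegenerate, consecutive sides meet only in their common vertex, and other sides
are disjoint. A vertex at which the two sides are collinear is allowed. -/
structure IsSimple (P : Polygon ℂ n) : Prop where
  three_le : 3 ≤ n
  nondegenerate : P.HasNondegenerateEdges
  inter_next : ∀ k, P.edgeSet ℝ k ∩ P.edgeSet ℝ (finRotate n k) = {P (finRotate n k)}
  disjoint : ∀ k l, k ≠ l → finRotate n k ≠ l → finRotate n l ≠ k →
    Disjoint (P.edgeSet ℝ k) (P.edgeSet ℝ l)

/-- The angle in `[0, 2π)` at the vertex `P k` on the left-hand side of the path
`P (k-1)`, `P k`, `P (k+1)`. For a simple polygon listed counterclockwise this is the inner angle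
`β`, and for one listed clockwise it is the outer angle `2π - β`. -/
def leftAngle (P : Polygon ℂ n) (k : Fin n) : ℝ :=
  toIcoMod Real.two_pi_pos 0
    (Complex.arg ((P ((finRotate n).symm k) - P k) / (P (finRotate n k) - P k)))

/-- The maximal angle among the inner and the outer angles of the polygon. -/
def maxAngle (P : Polygon ℂ n) : ℝ :=
  ⨆ k, max (P.leftAngle k) (2 * Real.pi - P.leftAngle k)

/-- The vector from the vertex `P k` along the bisector of the angle on the left, of
length `ε / sin (β / 2)`. -/
def bisector (P : Polygon ℂ n) (ε : ℝ) (k : Fin n) : ℂ :=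
  ((ε / Real.sin (P.leftAngle k / 2) : ℝ) : ℂ) *
    Complex.exp ((P.leftAngle k / 2 : ℝ) * Complex.I) *
    ((P (finRotate n k) - P k) / (‖P (finRotate n k) - P k‖ : ℝ))

/-- The point at distance `ε / sin (β / 2)` from `P k` on the bisector of the left angle. The
inner and the outer bisecting point of a corner are `leftPoint` and `rightPoint` for a polygon
listed counterclockwise, and the other way round for one listed clockwise. -/
def leftPoint (P : Polygon ℂ n) (ε : ℝ) (k : Fin n) : ℂ := P k + P.bisector ε k

/-- The point at distance `ε / sin (β / 2)` from `P k` on the bisector of the right angle. -/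
def rightPoint (P : Polygon ℂ n) (ε : ℝ) (k : Fin n) : ℂ := P k - P.bisector ε k

/-- The set of all inner and outer bisecting points, which are the vertices of the quadrilaterals
`quad ε k`. -/
def bisectingPoints (P : Polygon ℂ n) (ε : ℝ) : Set ℂ :=
  range (P.leftPoint ε) ∪ range (P.rightPoint ε)

/-- The open quadrilateral (trapezoid or rhomboid) along the side from `P k` to `P (k+1)`, with
two sides parallel to that side at distance `ε` from it, and two sides on the bisectors. -/
def quad (P : Polygon ℂ n) (ε : ℝ) (k : Fin n) : Set ℂ :=
  interior (convexHull ℝ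
    {P.leftPoint ε k, P.rightPoint ε k,
      P.leftPoint ε (finRotate n k), P.rightPoint ε (finRotate n k)})

/-- The inner polygon: `S`, with boundary `P`, without the closed quadrilaterals. -/
def innerPolygon (P : Polygon ℂ n) (S : Set ℂ) (ε : ℝ) : Set ℂ :=
  S \ ⋃ k, closure (P.quad ε k)

/-- The outer polygon: `S`, with boundary `P`, together with the interior of the union of the
closed quadrilaterals. -/
def outerPolygon (P : Polygon ℂ n) (S : Set ℂ) (ε : ℝ) : Set ℂ :=
  S ∪ interior (⋃ k, closure (P.quad ε k))

end Polygon

/-- `U` is an open simply connected polygon with its vertices in the finite set `V`: a bounded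
simply connected open set whose boundary is a finite union of segments with end points in `V`. -/
structure IsOpenPolygon (U V : Set ℂ) : Prop where
  isOpen : IsOpen U
  isBounded : Bornology.IsBounded U
  isSimplyConnected : IsSimplyConnected U
  finite : V.Finite
  exists_sides : ∃ E : Set (ℂ × ℂ), E ⊆ V ×ˢ V ∧ frontier U = ⋃ e ∈ E, segment ℝ e.1 e.2

/-- Hypothesis G for the region `S` with boundary components `F n`, prefractal polygonal regions
`R j` with boundary `P j`, side lengths `ℓ j`, angle bound `β₀` and constant `δ`. -/
structure HypothesisG (S : Set ℂ) {N : ℕ} (F : Fin N → SelfSimilarCurve)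
    {M : ℕ → ℕ} (P : ∀ j, Polygon ℂ (M j)) (R : ℕ → Set ℂ) (ℓ : ℕ → ℝ) (β₀ δ : ℝ) : Prop where
  region : IsBoundedRegion S (⋃ n, (F n).carrier)
  jordan : IsJordanCurve (⋃ n, (F n).carrier)
  /-- the sides of the polygon `P j` are the segments of step `j` of the curves `F n` -/
  sides : ∀ j, range ((P j).edgeSet ℝ) = ⋃ n, (F n).stepSides j
  simple : ∀ j, (P j).IsSimple
  prefractal : ∀ j, IsBoundedRegion (R j) ((P j).boundary ℝ)
  angle_mem : β₀ ∈ Ioo Real.pi (2 * Real.pi)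
  maxAngle_le : ∀ j, (P j).maxAngle ≤ β₀
  side_length : ∀ j k, dist (P j k) (P j (finRotate (M j) k)) = ℓ j
  length_lt : ∀ j, ℓ (j + 1) < ℓ j
  length_tendsto : Filter.Tendsto ℓ Filter.atTop (nhds 0)
  delta_pos : 0 < δ
  G1 : ∀ j m n, m ≠ n → Disjoint ((P j).quad (δ * ℓ j) m) ((P j).quad (δ * ℓ j) n)
  G2_inner : ∀ j, IsSimplyConnected ((P j).innerPolygon (R j) (δ * ℓ j))
  G2_outer : ∀ j, IsSimplyConnected ((P j).outerPolygon (R j) (δ * ℓ j))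
  G3 : ∀ j,
    (P (j + 1)).outerPolygon (R (j + 1)) (δ * ℓ (j + 1)) \
        (P (j + 1)).innerPolygon (R (j + 1)) (δ * ℓ (j + 1)) ⊆
      (P j).outerPolygon (R j) (δ * ℓ j) \ (P j).innerPolygon (R j) (δ * ℓ j)
  G4 : (⋂ j, (P j).innerPolygon (R j) (δ * ℓ j)).Nonempty

/-- Assumption A for the region `S` with boundary components `F n` and the inner and outer
polygons `T j` and `H j`, with vertices in `VT j` and `VH j`, except for the
computability of these vertices, which is a statement about particular `VT` and `VH`. -/
structure AssumptionA (S : Set ℂ) {N : ℕ} (F : Fin N → SelfSimilarCurve)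
    (T H VT VH : ℕ → Set ℂ) : Prop where
  isOpen : IsOpen S
  isSimplyConnected : IsSimplyConnected S
  inner_polygon : ∀ j, IsOpenPolygon (T j) (VT j)
  outer_polygon : ∀ j, IsOpenPolygon (H j) (VH j)
  A1 : ∀ j, T j ⊆ T (j + 1) ∧ T (j + 1) ⊆ S ∧ S ⊆ H (j + 1) ∧ H (j + 1) ⊆ H j
  A2 : ∀ ε : ℝ, 0 < ε → ∃ k, ∀ j, k ≤ j →
    {z | z ∈ H j ∧ ε ≤ Metric.infDist z (frontier (H j))} ⊆ T j
  A3 : frontier S = ⋃ n, (F n).carrier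

end

/-!
The layer between the inner polygon `T j` and the outer polygon `H j` is covered by the closed
quadrilaterals along the sides of the prefractal polygon. By the bound on the angles their
diameters are at most a multiple of `ℓ j`, and by self-similarity each side is within a multiple
of `ℓ j` of the curve `J = ⋃ n, F n`. So the layers, which are nested by (G3), converge to `J`,
and the rest is plane topology (`IsLayerApproximation`).

* `T j ⊆ T (j + 1)` since `T j` is connected and does not meet the boundary of `T (j + 1)`. For
  `H (j + 1) ⊆ H j`, the part of `T (j + 1)` outside `H j` would be a compact and relatively open
  part of the complement of `H j`, which a simply connected set does not have
  (`IsSimplyConnected.compact_hole_eq_empty`).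
* `⋃ j, T j` is a bounded open set with its boundary in `J`, and so is `S`. A Jordan curve has
  only one bounded complementary region (`IsJordanCurve.not_disjoint`), hence `S = ⋃ j, T j`. This
  gives the inclusions of (A1), and `S` is simply connected as an increasing union of simply
  connected open sets.
* (A2) holds because every point of `J` is a limit of exterior points of `S`
  (`IsJordanCurve.subset_closure_compl_closure`), and each exterior point is outside `H j` for
  large `j`.

The facts about Jordan curves are proved by continuous logarithms: a nonvanishing function on the
circle is a power times an exponential, while `z - s` has no continuous logarithm on the boundary
of a bounded open set that contains `s`.

That the inner and the outer polygon are bounded by segments between bisecting points is local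
geometry. In the coordinates of a side, the closed quadrilateral is given by three linear
inequalities; for this the disjointness (G1) is needed, which prevents the bisectors from crossing
too early. A point of the boundary of `T j` or `H j` is on a side of a quadrilateral that is
parallel to a side of the polygon. If it is not a bisecting point, it belongs to just one closed
quadrilateral: two disjoint ones are opposite half-planes near this point and would together be a
neighbourhood of it. Therefore the boundary contains, with any such point, the whole part of the
parallel side up to the next bisecting points (`Polygon.HasDisjointQuads.exists_sides_frontier`).
-/

section

open Complex Metric Topology

/-! ### Continuous logarithms and complementary components -/

theorem eq_of_exp_comp_const {φ : ℝ → ℂ} (hφ : Continuous φ)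
    (h : ∀ a b, exp (φ a) = exp (φ b)) (a b : ℝ) : φ a = φ b :=
  isCoveringMap_exp.const_of_comp hφ (fun a a' => Subtype.ext (h a a')) a b

theorem isSimplyConnected_univ_of_contractible (X : Type*) [TopologicalSpace X]
    [ContractibleSpace X] : IsSimplyConnected (univ : Set X) :=
  (Homeomorph.Set.univ X).toHomotopyEquiv.simplyConnectedSpace_iff.2 inferInstance

/-- A nonvanishing continuous function on a contractible locally path connected space has a
continuous logarithm. -/
theorem exists_continuous_log {X : Type*} [TopologicalSpace X] [LocallyPathConnectedSpace X]
    [ContractibleSpace X] {G : X → ℂ} (hG : Continuous G) (h0 : ∀ x, G x ≠ 0) :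
    ∃ f : X → ℂ, Continuous f ∧ ∀ x, exp (f x) = G x := by
  obtain ⟨f, hf, hfG⟩ := exists_continuousOn_eqOn_exp_comp
    (isSimplyConnected_univ_of_contractible X) isOpen_univ hG.continuousOn
    (by rintro ⟨x, -, hx⟩; exact h0 x hx)
  exact ⟨f, continuousOn_univ.1 hf, fun x => hfG (mem_univ x)⟩

/-- A nonvanishing continuous function on the plane has winding number zero along large circles. -/
theorem exponent_eq_zero_of_eq_zpow {G : ℂ → ℂ} (hG : Continuous G) (h0 : ∀ z, G z ≠ 0)
    {s : ℂ} {m : ℤ} {U : Set ℂ} (hU : Bornology.IsBounded U)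
    (h : ∀ z, z ∉ U → G z = (z - s) ^ m) : m = 0 := by
  obtain ⟨f, hf, hfG⟩ := exists_continuous_log hG h0
  obtain ⟨r, hr0, hr⟩ := hU.subset_ball_lt 0 s
  have hrm : ((r : ℂ) ^ m) ≠ 0 := zpow_ne_zero _ (by exact_mod_cast hr0.ne')
  have key : ∀ t : ℝ, exp (f (s + r * exp (t * I)) - m * (t * I)) = (r : ℂ) ^ m := by
    intro t
    have hnot : s + r * exp (t * I) ∉ U := by
      intro hmem
      have := hr hmem
      simp [norm_exp_ofReal_mul_I, abs_of_pos hr0] at this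
    rw [exp_sub, hfG, h _ hnot, add_sub_cancel_left, mul_zpow, exp_int_mul,
      mul_div_assoc, div_self, mul_one]
    exact zpow_ne_zero _ (exp_ne_zero _)
  have hc : Continuous fun t : ℝ => f (s + r * exp (t * I)) - m * (t * I) := by fun_prop
  have := eq_of_exp_comp_const hc (fun a b => by rw [key, key]) 0 (2 * Real.pi)
  push_cast at this
  rw [exp_two_pi_mul_I, zero_mul, exp_zero, sub_right_inj] at this
  simpa [Real.pi_ne_zero, I_ne_zero, eq_comm] using this

/-- The winding number of the boundary of a bounded open set `U` about a point of `U` is an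
obstruction to extending a nonvanishing function from the boundary to `U`. -/
theorem exponent_eq_zero_of_extends {U : Set ℂ} (hUb : Bornology.IsBounded U)
    (hUo : IsOpen U) {s : ℂ} (hs : s ∈ U) {h : ℂ → ℂ} (hc : ContinuousOn h (closure U))
    (h0 : ∀ z ∈ closure U, h z ≠ 0) {m : ℤ} (hm : ∀ z ∈ frontier U, h z = (z - s) ^ m) :
    m = 0 := by
  classical
  let G : ℂ → ℂ := fun z => if z ∈ closure U then h z else (z - s) ^ m
  have hsub : ∀ z, z ∉ U → z - s ≠ 0 := fun z hz h => hz (by rwa [sub_eq_zero.1 h])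
  have hGout : ∀ z, z ∉ U → G z = (z - s) ^ m := by
    intro z hz
    by_cases hzc : z ∈ closure U
    · simp only [G, if_pos hzc]
      exact hm z (by rw [hUo.frontier_eq]; exact ⟨hzc, hz⟩)
    · simp only [G, if_neg hzc]
  refine exponent_eq_zero_of_eq_zpow (G := G) ?_ (fun z => ?_) hUb hGout
  · rw [← continuousOn_univ, show (univ : Set ℂ) = closure U ∪ Uᶜ from
      (eq_univ_of_forall fun z => (em (z ∈ U)).imp (fun h => subset_closure h) id).symm]
    refine ContinuousOn.union_of_isClosed ?_ ?_ isClosed_closure hUo.isClosed_compl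
    · exact hc.congr fun z hz => if_pos hz
    · refine ContinuousOn.congr (f := fun z => (z - s) ^ m) ?_ fun z hz => hGout z hz
      exact (by fun_prop : Continuous fun z : ℂ => z - s).continuousOn.zpow₀ m
        fun z hz => Or.inl (hsub z hz)
  · by_cases hz : z ∈ closure U
    · simp only [G, if_pos hz]; exact h0 z hz
    · simp only [G, if_neg hz]
      exact zpow_ne_zero _ (hsub z fun h => hz (subset_closure h))

theorem exists_continuous_extension {J : Set ℂ} (hJ : IsClosed J) {g : ℂ → ℂ}
    (hg : ContinuousOn g J) : ∃ G : ℂ → ℂ, Continuous G ∧ EqOn G g J := by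
  obtain ⟨G, hG⟩ := ContinuousMap.exists_restrict_eq hJ ⟨J.domRestrict g, hg.domRestrict⟩
  exact ⟨G, G.continuous, fun x hx => congrArg (fun F : C(J, ℂ) => F ⟨x, hx⟩) hG⟩

/-- There is no continuous logarithm of `z - s` on a closed set that contains the boundary of a
bounded open neighbourhood of `s`. -/
theorem not_exists_log_on_frontier {U J : Set ℂ} (hUb : Bornology.IsBounded U)
    (hUo : IsOpen U) {s : ℂ} (hs : s ∈ U) (hJ : IsClosed J) (hUJ : frontier U ⊆ J) {g : ℂ → ℂ}
    (hg : ContinuousOn g J) (hexp : ∀ z ∈ J, exp (g z) = z - s) : False := by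
  obtain ⟨G, hG, hGg⟩ := exists_continuous_extension hJ hg
  refine one_ne_zero (exponent_eq_zero_of_extends (m := 1) hUb hUo hs
    (h := fun z => exp (G z)) (by fun_prop) (fun z _ => exp_ne_zero _) fun z hz => ?_)
  rw [hGg (hUJ hz), hexp z (hUJ hz), zpow_one]

/-- The complement of a simply connected open set of the plane has no compact part that is
open in this complement. -/
theorem IsSimplyConnected.compact_hole_eq_empty {H C : Set ℂ} (hH : IsSimplyConnected H)
    (hHo : IsOpen H) (hC : IsCompact C) (hd : Disjoint H C) (ho : IsOpen (H ∪ C)) : C = ∅ := by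
  by_contra hne
  obtain ⟨s, hs⟩ := nonempty_iff_ne_empty.2 hne
  have hsH : s ∉ H := fun h => disjoint_left.1 hd h hs
  obtain ⟨K, hK, hCK, hKU⟩ := exists_compact_between hC ho subset_union_right
  obtain ⟨f, hf, hfe⟩ := exists_continuousOn_eqOn_exp_comp hH hHo (g := fun z => z - s)
    (by fun_prop) (by rintro ⟨z, hz, h⟩; exact hsH (by rwa [← sub_eq_zero.1 h]))
  have hfr : frontier (interior K) ⊆ H := by
    intro z hz
    rw [isOpen_interior.frontier_eq] at hz
    have hzK : z ∈ K := hK.isClosed.closure_subset_iff.2 interior_subset hz.1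
    exact (hKU hzK).resolve_right fun h => hz.2 (hCK h)
  exact not_exists_log_on_frontier (hK.isBounded.subset interior_subset) isOpen_interior
    (hCK hs) isClosed_frontier Subset.rfl (hf.mono hfr) fun z hz => hfe (hfr hz)

/-! ### Complementary regions of a Jordan curve -/

/-- A nonvanishing function on the circle is a power times an exponential. -/
theorem exists_zpow_mul_exp {f : Circle → ℂ} (hf : Continuous f) (h0 : ∀ z, f z ≠ 0) :
    ∃ (p : ℤ) (g : Circle → ℂ), Continuous g ∧ ∀ z, f z = (z : ℂ) ^ p * exp (g z) := by
  obtain ⟨L, hL, hLe⟩ := exists_continuous_log (G := fun t : ℝ => f (Circle.exp t))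
    (by fun_prop) fun t => h0 _
  have hshift : ∀ t : ℝ, L (t + 2 * Real.pi) - L t = L (0 + 2 * Real.pi) - L 0 := by
    intro t
    refine eq_of_exp_comp_const (φ := fun t : ℝ => L (t + 2 * Real.pi) - L t) (by fun_prop)
      (fun a b => ?_) t 0
    simp only [exp_sub, hLe, Circle.exp_add_two_pi, div_self (h0 _)]
  obtain ⟨p, hp⟩ := exp_eq_exp_iff_exists_int.1
    (show exp (L (0 + 2 * Real.pi)) = exp (L 0) by rw [hLe, hLe, Circle.exp_add_two_pi])
  have hper : Function.Periodic (fun t : ℝ => L t - p * (t * I)) (2 * Real.pi) := by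
    intro t
    have := hshift t
    rw [hp] at this
    have h2 : L (t + 2 * Real.pi) = L t + p * (2 * Real.pi * I) := by linear_combination this
    simp only [h2]; push_cast; ring
  have hval : ∀ t : ℝ, L (arg (Circle.exp t : ℂ)) - p * ((arg (Circle.exp t : ℂ) : ℝ) * I)
      = L t - p * (t * I) := by
    intro t
    have h1 : Circle.exp (arg (Circle.exp t : ℂ)) = Circle.exp t := Circle.exp_arg _
    obtain ⟨n, hn⟩ := Circle.exp_eq_exp.1 h1
    rw [hn]
    exact (hper.int_mul n) t
  refine ⟨p, fun z => L (arg (z : ℂ)) - p * ((arg (z : ℂ) : ℝ) * I), ?_, fun z => ?_⟩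
  · rw [(Circle.isCoveringMap_exp.isQuotientMap
      fun z => ⟨_, Circle.exp_arg z⟩).continuous_iff]
    have : ((fun z : Circle => L (arg (z : ℂ)) - p * ((arg (z : ℂ) : ℝ) * I)) ∘ Circle.exp)
        = fun t : ℝ => L t - p * (t * I) := funext hval
    rw [this]; fun_prop
  · obtain ⟨t, rfl⟩ : ∃ t, Circle.exp t = z := ⟨_, Circle.exp_arg z⟩
    simp only [hval]
    rw [exp_sub, hLe, exp_int_mul, Circle.coe_exp, mul_div_cancel₀]
    exact zpow_ne_zero _ (exp_ne_zero _)

/-- A parametrization `γ` of a Jordan curve and its continuous inverse `σ`. -/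
theorem IsJordanCurve.exists_inverse {J : Set ℂ} (hJ : IsJordanCurve J) :
    IsCompact J ∧ ∃ (γ : Circle → ℂ) (σ : ℂ → Circle), Continuous γ ∧ ContinuousOn σ J ∧
      (∀ w, γ w ∈ J) ∧ ∀ z ∈ J, γ (σ z) = z := by
  obtain ⟨γ, hγ, hinj, rfl⟩ := hJ
  have hemb := hγ.isClosedEmbedding hinj
  refine ⟨isCompact_range hγ, γ, Function.invFun γ, hγ, ?_, fun w => mem_range_self w, ?_⟩
  · rw [continuousOn_iff_continuous_domRestrict]
    have : (range γ).domRestrict (Function.invFun γ) = hemb.toHomeomorph.symm := by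
      funext ⟨_, w, rfl⟩
      have h2 : hemb.toHomeomorph.symm (hemb.toHomeomorph w) = w := by simp
      exact (Function.leftInverse_invFun hinj w).trans h2.symm
    rw [this]
    exact hemb.toHomeomorph.symm.continuous
  · rintro _ ⟨w, rfl⟩
    rw [Function.leftInverse_invFun hinj w]

/-- On a Jordan curve parametrized by the inverse of `σ`, the function `z - s` is a power of
`σ` times an exponential. -/
theorem exists_sub_eq_zpow_mul_exp {J : Set ℂ} {γ : Circle → ℂ} {σ : ℂ → Circle}
    (hγ : Continuous γ) (hσ : ContinuousOn σ J) (hγJ : ∀ w, γ w ∈ J)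
    (hγσ : ∀ z ∈ J, γ (σ z) = z) {s : ℂ} (hs : s ∉ J) :
    ∃ (p : ℤ) (g : ℂ → ℂ), ContinuousOn g J ∧ ∀ z ∈ J, z - s = (σ z : ℂ) ^ p * exp (g z) := by
  obtain ⟨p, g, hg, h⟩ := exists_zpow_mul_exp (f := fun w => γ w - s) (by fun_prop)
    fun w hw => hs (by rw [← sub_eq_zero.1 hw]; exact hγJ w)
  refine ⟨p, fun z => g (σ z), hg.comp_continuousOn hσ, fun z hz => ?_⟩
  have := h (σ z)
  rwa [hγσ z hz] at this

/-- Two bounded open sets with their boundaries in a Jordan curve and not meeting this curve have a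
common point: this is the part of the Jordan curve theorem saying that the interior is
connected. -/
theorem IsJordanCurve.not_disjoint {J U V : Set ℂ} (hJ : IsJordanCurve J)
    (hUo : IsOpen U) (hVo : IsOpen V) (hUb : Bornology.IsBounded U) (hVb : Bornology.IsBounded V)
    (hU : U.Nonempty) (hV : V.Nonempty) (hUJ : frontier U ⊆ J) (hVJ : frontier V ⊆ J)
    (hUd : Disjoint U J) (hVd : Disjoint V J) : ¬ Disjoint U V := by
  intro hd
  obtain ⟨hJc, γ, σ, hγ, hσ, hγJ, hγσ⟩ := hJ.exists_inverse
  obtain ⟨u, hu⟩ := hU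
  obtain ⟨v, hv⟩ := hV
  obtain ⟨p, g, hg, hpg⟩ := exists_sub_eq_zpow_mul_exp hγ hσ hγJ hγσ (disjoint_left.1 hUd hu)
  obtain ⟨q, k, hk, hqk⟩ := exists_sub_eq_zpow_mul_exp hγ hσ hγJ hγσ (disjoint_left.1 hVd hv)
  -- `(z - u) ^ q` and `(z - v) ^ p` differ by an exponential on `J`, and `u` is outside `V`.
  obtain ⟨G, hG, hGe⟩ := exists_continuous_extension hJc.isClosed
    (g := fun z => p * k z - q * g z) (by fun_prop)
  have huV : u ∉ closure V := fun h =>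
    let ⟨_, hx⟩ := mem_closure_iff.1 h U hUo hu
    disjoint_left.1 hd hx.1 hx.2
  have hne : ∀ z ∈ closure V, z - u ≠ 0 := fun z hz h => huV (by rwa [← sub_eq_zero.1 h])
  have hp : p = 0 := by
    refine exponent_eq_zero_of_extends hVb hVo hv (h := fun z => (z - u) ^ q * exp (G z))
      ?_ ?_ fun z hz => ?_
    · refine ContinuousOn.mul ?_ (by fun_prop)
      exact (by fun_prop : Continuous fun z : ℂ => z - u).continuousOn.zpow₀ q
        fun z hz => Or.inl (hne z hz)
    · exact fun z hz => mul_ne_zero (zpow_ne_zero _ (hne z hz)) (exp_ne_zero _)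
    · have hz := hVJ hz
      rw [hGe hz, hpg z hz, hqk z hz, mul_zpow, mul_zpow, ← zpow_mul, ← zpow_mul, mul_comm q p,
        mul_assoc, ← exp_int_mul, ← exp_int_mul, ← exp_add]
      congr 2; ring
  subst hp
  exact not_exists_log_on_frontier hUb hUo hu hJc.isClosed hUJ hg fun z hz => by
    rw [hpg z hz, zpow_zero, one_mul]

/-- Every point of a Jordan curve that is the boundary of a bounded region is a limit of points
outside the closure of the region. -/
theorem IsJordanCurve.subset_closure_compl_closure {J U : Set ℂ} (hJ : IsJordanCurve J)
    (hUo : IsOpen U) (hUb : Bornology.IsBounded U) (hU : U.Nonempty) (hUJ : frontier U = J) :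
    J ⊆ closure (closure U)ᶜ := by
  intro x hx
  rw [closure_compl]
  intro hxi
  obtain ⟨hJc, γ, σ, hγ, hσ, hγJ, hγσ⟩ := hJ.exists_inverse
  obtain ⟨s, hs⟩ := hU
  have hsJ : s ∉ J := by rw [← hUJ, hUo.frontier_eq]; exact fun h => h.2 hs
  obtain ⟨p, g, hg, hpg⟩ := exists_sub_eq_zpow_mul_exp hγ hσ hγJ hγσ hsJ
  -- `σ` has a continuous logarithm away from `x`.
  let w : ℂ := σ x
  have hw : w ≠ 0 := Circle.coe_ne_zero _
  let K : Set ℂ := J \ interior (closure U)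
  have hslit : ∀ z ∈ K, -(σ z : ℂ) / w ∈ slitPlane := by
    intro z hz
    have hn : ‖-(σ z : ℂ) / w‖ = 1 := by
      rw [norm_div, norm_neg, Circle.norm_coe, Circle.norm_coe, div_one]
    rw [mem_slitPlane_iff_arg]
    refine ⟨fun harg => ?_, fun h => by rw [h, norm_zero] at hn; exact zero_ne_one hn⟩
    have h1 := norm_mul_exp_arg_mul_I (-(σ z : ℂ) / w)
    rw [hn, harg, exp_pi_mul_I] at h1
    have h2 : (σ z : ℂ) = w := by
      rw [eq_div_iff hw] at h1
      push_cast at h1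
      linear_combination h1
    have h3 : σ z = σ x := Subtype.ext h2
    have h4 : z = x := by rw [← hγσ z hz.1, ← hγσ x hx, h3]
    exact hz.2 (h4 ▸ hxi)
  have hKc : IsClosed K := hJc.isClosed.sdiff isOpen_interior
  have hσ' : ContinuousOn (fun z => (σ z : ℂ)) K :=
    continuous_subtype_val.comp_continuousOn (hσ.mono sdiff_subset)
  have hsU : U ⊆ interior (closure U) := hUo.subset_interior_iff.2 subset_closure
  refine not_exists_log_on_frontier (U := interior (closure U)) (J := K) (s := s)
    (g := fun z => p * (log (-w) + log (-(σ z : ℂ) / w)) + g z)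
    (hUb.closure.subset interior_subset) isOpen_interior (hsU hs) hKc ?_ ?_ fun z hz => ?_
  · intro z hz
    rw [isOpen_interior.frontier_eq] at hz
    refine ⟨?_, hz.2⟩
    rw [← hUJ, hUo.frontier_eq]
    exact ⟨isClosed_closure.closure_subset_iff.2 interior_subset hz.1, fun h => hz.2 (hsU h)⟩
  · refine ContinuousOn.add (ContinuousOn.mul continuousOn_const
      (continuousOn_const.add ?_)) (hg.mono sdiff_subset)
    exact (hσ'.neg.div_const w).clog hslit
  · have h1 : -(σ z : ℂ) / w ≠ 0 := slitPlane_ne_zero (hslit z hz)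
    rw [exp_add, exp_int_mul, exp_add, exp_log (neg_ne_zero.2 hw), exp_log h1, hpg z hz.1]
    congr 2
    field_simp

/-- The union of an increasing sequence of simply connected open sets is simply connected. -/
theorem isSimplyConnected_iUnion_of_monotone {X : Type*} [TopologicalSpace X] {T : ℕ → Set X}
    (hT : Monotone T) (ho : ∀ j, IsOpen (T j)) (hs : ∀ j, IsSimplyConnected (T j)) :
    IsSimplyConnected (⋃ j, T j) := by
  have hdir : Directed (· ⊆ ·) T := hT.directed_le
  rw [isSimplyConnected_iff_exists_homotopy_refl_forall_mem]
  refine ⟨?_, fun x p hp => ?_⟩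
  · obtain ⟨x, hx⟩ := (hs 0).nonempty
    refine ⟨x, mem_iUnion_of_mem 0 hx, fun {y} hy => ?_⟩
    obtain ⟨j, hj⟩ := mem_iUnion.1 hy
    exact ((hs j).isPathConnected.joinedIn x (hT (Nat.zero_le j) hx) y hj).mono
      (subset_iUnion T j)
  · obtain ⟨j, hj⟩ := (isCompact_range p.continuous).elim_directed_cover T ho
      (range_subset_iff.2 hp) hdir
    obtain ⟨F, hF⟩ := (isSimplyConnected_iff_exists_homotopy_refl_forall_mem.1 (hs j)).2 x p
      (range_subset_iff.1 hj)
    exact ⟨F, fun t => mem_iUnion_of_mem j (hF t)⟩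

/-! ### Trapezoids with two horizontal sides -/

theorem mem_segment_of_im_eq {a b z : ℂ} (ha : a.im = z.im) (hb : b.im = z.im)
    (h1 : a.re ≤ z.re) (h2 : z.re ≤ b.re) : z ∈ segment ℝ a b := by
  have hz : z.re ∈ segment ℝ a.re b.re := by rw [segment_eq_Icc (h1.trans h2)]; exact ⟨h1, h2⟩
  obtain ⟨s, t, hs, ht, hst, h⟩ := hz
  refine ⟨s, t, hs, ht, hst, Complex.ext (by simpa using h) ?_⟩
  simp only [add_im, smul_im, smul_eq_mul, ha, hb]
  rw [← add_mul, hst, one_mul]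

/-- The closed trapezoid between the lines `im z = -ε` and `im z = ε`, with the vertices `p`, `q`
on the lower line and `r`, `s` on the upper one. -/
def closedTrapezoid (ε p q r s : ℝ) : Set ℂ :=
  {z | |z.im| ≤ ε ∧ (ε - z.im) * p + (ε + z.im) * r ≤ 2 * ε * z.re ∧
    2 * ε * z.re ≤ (ε - z.im) * q + (ε + z.im) * s}

theorem convex_closedTrapezoid (ε p q r s : ℝ) : Convex ℝ (closedTrapezoid ε p q r s) := by
  rintro x ⟨hx1, hx2, hx3⟩ y ⟨hy1, hy2, hy3⟩ a b ha hb hab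
  obtain rfl : b = 1 - a := by linarith
  rw [abs_le] at hx1 hy1
  simp only [closedTrapezoid, mem_ofPred_eq, add_im, smul_im, smul_eq_mul, add_re, smul_re, abs_le]
  refine ⟨⟨?_, ?_⟩, ?_, ?_⟩
  · linarith [mul_le_mul_of_nonneg_left hx1.1 ha, mul_le_mul_of_nonneg_left hy1.1 hb]
  · linarith [mul_le_mul_of_nonneg_left hx1.2 ha, mul_le_mul_of_nonneg_left hy1.2 hb]
  · linarith [mul_le_mul_of_nonneg_left hx2 ha, mul_le_mul_of_nonneg_left hy2 hb]
  · linarith [mul_le_mul_of_nonneg_left hx3 ha, mul_le_mul_of_nonneg_left hy3 hb]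

theorem convexHull_eq_closedTrapezoid {ε p q r s : ℝ} (hε : 0 < ε) (hpq : p ≤ q) (hrs : r ≤ s) :
    convexHull ℝ {(⟨r, ε⟩ : ℂ), ⟨p, -ε⟩, ⟨s, ε⟩, ⟨q, -ε⟩} = closedTrapezoid ε p q r s := by
  apply Subset.antisymm
  · refine convexHull_min ?_ (convex_closedTrapezoid ..)
    have h1 := mul_le_mul_of_nonneg_left hpq hε.le
    have h2 := mul_le_mul_of_nonneg_left hrs hε.le
    rintro z (rfl | rfl | rfl | rfl) <;>
      simp only [closedTrapezoid, mem_ofPred_eq, abs_neg, abs_of_pos hε] <;>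
      refine ⟨le_rfl, ?_, ?_⟩ <;> linarith
  · rintro z ⟨hz1, hz2, hz3⟩
    rw [abs_le] at hz1
    have hS := convex_convexHull ℝ {(⟨r, ε⟩ : ℂ), ⟨p, -ε⟩, ⟨s, ε⟩, ⟨q, -ε⟩}
    have hsub := subset_convexHull ℝ {(⟨r, ε⟩ : ℂ), ⟨p, -ε⟩, ⟨s, ε⟩, ⟨q, -ε⟩}
    -- `z` lies between the points of the two lateral sides at its height
    let t : ℝ := (ε + z.im) / (2 * ε)
    have ht : 2 * ε * t = ε + z.im := by simp only [t]; field_simp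
    have ht' : 2 * ε * (1 - t) = ε - z.im := by linarith
    have ht0 : 0 ≤ t := div_nonneg (by linarith) (by linarith)
    have ht1 : 0 ≤ 1 - t := by
      have : 0 ≤ 2 * ε * (1 - t) := by linarith
      exact nonneg_of_mul_nonneg_right this (by linarith)
    have hl := hS (hsub (show (⟨p, -ε⟩ : ℂ) ∈ _ by simp)) (hsub (show (⟨r, ε⟩ : ℂ) ∈ _ by simp))
      ht1 ht0 (by ring)
    have hr := hS (hsub (show (⟨q, -ε⟩ : ℂ) ∈ _ by simp)) (hsub (show (⟨s, ε⟩ : ℂ) ∈ _ by simp))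
      ht1 ht0 (by ring)
    refine hS.segment_subset hl hr (mem_segment_of_im_eq ?_ ?_ ?_ ?_)
    · simp only [add_im, smul_im, smul_eq_mul]; linarith
    · simp only [add_im, smul_im, smul_eq_mul]; linarith
    · simp only [add_re, smul_re, smul_eq_mul]
      rw [← ht, ← ht'] at hz2
      have : 2 * ε * ((1 - t) * p + t * r) ≤ 2 * ε * z.re := by linarith
      exact le_of_mul_le_mul_left this (by linarith)
    · simp only [add_re, smul_re, smul_eq_mul]
      rw [← ht, ← ht'] at hz3
      have : 2 * ε * z.re ≤ 2 * ε * ((1 - t) * q + t * s) := by linarith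
      exact le_of_mul_le_mul_left this (by linarith)

theorem exists_pos_add_smul_mem {K : Set ℂ} {z : ℂ} (hz : z ∈ interior K) (v : ℂ) :
    ∃ t : ℝ, 0 < t ∧ z + t * v ∈ K := by
  have hc : Filter.Tendsto (fun t : ℝ => z + t * v) (𝓝[>] 0) (𝓝 z) := by
    have : Continuous fun t : ℝ => z + t * v := by fun_prop
    simpa using (this.tendsto 0).mono_left nhdsWithin_le_nhds
  obtain ⟨t, ht, ht0⟩ := ((hc.eventually (mem_interior_iff_mem_nhds.1 hz)).and
    self_mem_nhdsWithin).exists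
  exact ⟨t, ht0, ht⟩

theorem mem_interior_closedTrapezoid {ε p q r s : ℝ} (hε : 0 < ε) {z : ℂ} :
    z ∈ interior (closedTrapezoid ε p q r s) ↔
      |z.im| < ε ∧ (ε - z.im) * p + (ε + z.im) * r < 2 * ε * z.re ∧
        2 * ε * z.re < (ε - z.im) * q + (ε + z.im) * s := by
  constructor
  · intro hz
    obtain ⟨t1, ht1, h1, -, -⟩ := exists_pos_add_smul_mem hz I
    obtain ⟨t2, ht2, h2, -, -⟩ := exists_pos_add_smul_mem hz (-I)
    obtain ⟨t3, ht3, -, h3, -⟩ := exists_pos_add_smul_mem hz (-1)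
    obtain ⟨t4, ht4, -, -, h4⟩ := exists_pos_add_smul_mem hz 1
    simp at h1 h2 h3 h4
    rw [abs_le] at h1 h2
    have := mul_pos hε ht3
    have := mul_pos hε ht4
    exact ⟨abs_lt.2 ⟨by linarith, by linarith⟩, by linarith, by linarith⟩
  · rintro ⟨h1, h2, h3⟩
    refine mem_interior.2 ⟨{z | |z.im| < ε ∧ (ε - z.im) * p + (ε + z.im) * r < 2 * ε * z.re ∧
        2 * ε * z.re < (ε - z.im) * q + (ε + z.im) * s}, ?_, ?_, h1, h2, h3⟩
    · rintro w ⟨h1, h2, h3⟩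
      exact ⟨h1.le, h2.le, h3.le⟩
    · simp only [ofPred_and]
      exact (isOpen_lt (by fun_prop) (by fun_prop)).inter
        ((isOpen_lt (by fun_prop) (by fun_prop)).inter (isOpen_lt (by fun_prop) (by fun_prop)))

/-- The convex hull for any order of the vertices on the two lines. -/
theorem convexHull_eq_closedTrapezoid_min_max {ε p q r s : ℝ} (hε : 0 < ε) :
    convexHull ℝ {(⟨r, ε⟩ : ℂ), ⟨p, -ε⟩, ⟨s, ε⟩, ⟨q, -ε⟩} =
      closedTrapezoid ε (min p q) (max p q) (min r s) (max r s) := by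
  rw [← convexHull_eq_closedTrapezoid hε min_le_max min_le_max]
  congr 1
  rcases le_total p q with h | h <;> rcases le_total r s with h' | h' <;>
    simp only [min_eq_left, max_eq_right, min_eq_right, max_eq_left, h, h'] <;>
    ext z <;> simp only [mem_insert_iff, mem_singleton_iff] <;> tauto

/-! ### The quadrilaterals along the sides of a polygon -/

namespace Polygon

variable {n : ℕ} {P : Polygon ℂ n} {ε : ℝ} {k : Fin n}

/-- The unit vector along the side from `P k` to `P (k+1)`. -/
noncomputable def dir (P : Polygon ℂ n) (k : Fin n) : ℂ :=
  (P (finRotate n k) - P k) / (‖P (finRotate n k) - P k‖ : ℝ)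

/-- The length of the side from `P k` to `P (k+1)`. -/
noncomputable def sideLength (P : Polygon ℂ n) (k : Fin n) : ℝ := ‖P (finRotate n k) - P k‖

/-- The coordinate of `z` in the orthonormal frame with the origin at `P k` and the real axis along
the side from `P k` to `P (k+1)`. -/
noncomputable def coord (P : Polygon ℂ n) (k : Fin n) (z : ℂ) : ℂ :=
  (z - P k) * (starRingEnd ℂ) (P.dir k)

/-- The position of `z` relative to the bisector at `P k`: zero on this bisector, negative on the
side of `P (k+1)` and positive on the side of `P (k-1)`. -/
noncomputable def bisectorForm (P : Polygon ℂ n) (ε : ℝ) (k : Fin n) (z : ℂ) : ℝ :=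
  ((z - P k) * (starRingEnd ℂ) (P.bisector ε k)).im

/-- The component of the bisecting vector at `P k` along the side from `P k` to `P (k+1)`. -/
noncomputable def bisectorShift (P : Polygon ℂ n) (ε : ℝ) (k : Fin n) : ℝ :=
  ε * (Real.cos (P.leftAngle k / 2) / Real.sin (P.leftAngle k / 2))

theorem sideLength_pos (hP : P.HasNondegenerateEdges) (k : Fin n) : 0 < P.sideLength k :=
  norm_pos_iff.2 (sub_ne_zero.2 (hP k).symm)

theorem vertex_sub (hP : P.HasNondegenerateEdges) (k : Fin n) :
    P (finRotate n k) - P k = P.sideLength k * P.dir k := by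
  have : ((P.sideLength k : ℝ) : ℂ) ≠ 0 := by exact_mod_cast (sideLength_pos hP k).ne'
  rw [dir, sideLength] at *
  field_simp

theorem norm_dir (hP : P.HasNondegenerateEdges) (k : Fin n) : ‖P.dir k‖ = 1 := by
  have := (sideLength_pos hP k).ne'
  rw [sideLength] at this
  rw [dir, norm_div, norm_real, norm_norm, div_self this]

theorem dir_ne_zero (hP : P.HasNondegenerateEdges) (k : Fin n) : P.dir k ≠ 0 :=
  norm_ne_zero_iff.1 (by rw [norm_dir hP]; exact one_ne_zero)

theorem dir_mul_conj (hP : P.HasNondegenerateEdges) (k : Fin n) :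
    P.dir k * (starRingEnd ℂ) (P.dir k) = 1 := by
  rw [mul_conj, normSq_eq_norm_sq, norm_dir hP]; simp

theorem eq_add_coord_mul (hP : P.HasNondegenerateEdges) (k : Fin n) (z : ℂ) :
    z = P k + P.dir k * P.coord k z := by
  rw [coord, mul_left_comm, dir_mul_conj hP, mul_one, add_sub_cancel]

theorem coord_add_mul (hP : P.HasNondegenerateEdges) (k : Fin n) (w : ℂ) :
    P.coord k (P k + P.dir k * w) = w := by
  rw [coord, add_sub_cancel_left, mul_right_comm, dir_mul_conj hP, one_mul]

theorem leftAngle_lt (P : Polygon ℂ n) (k : Fin n) : P.leftAngle k < 2 * Real.pi := by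
  have := toIcoMod_lt_right Real.two_pi_pos 0 (Complex.arg
    ((P ((finRotate n).symm k) - P k) / (P (finRotate n k) - P k)))
  rwa [zero_add] at this

/-- The rotation by the left angle carries the following side to the direction of the preceding
one. -/
theorem exp_leftAngle_mul_dir (hP : P.HasNondegenerateEdges) (k : Fin n) :
    exp (P.leftAngle k * I) * P.dir k = -P.dir ((finRotate n).symm k) := by
  set x : ℂ := (P ((finRotate n).symm k) - P k) / (P (finRotate n k) - P k) with hx
  have h1 : exp (P.leftAngle k * I) = exp (x.arg * I) := by
    rw [leftAngle, ← hx, toIcoMod]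
    push_cast
    rw [exp_eq_exp_iff_exists_int]
    refine ⟨-toIcoDiv Real.two_pi_pos 0 x.arg, ?_⟩
    simp only [zsmul_eq_mul]
    push_cast
    ring
  have h2 := norm_mul_exp_arg_mul_I x
  have h3 := vertex_sub hP k
  have h4 := vertex_sub hP ((finRotate n).symm k)
  rw [Equiv.apply_symm_apply] at h4
  have hl := sideLength_pos hP k
  have hl' := sideLength_pos hP ((finRotate n).symm k)
  have hd := dir_ne_zero hP k
  have h5 : x = -(P.sideLength ((finRotate n).symm k) * P.dir ((finRotate n).symm k)) /
      (P.sideLength k * P.dir k) := by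
    rw [hx, h3, ← h4, neg_sub]
  have h6 : ‖x‖ = P.sideLength ((finRotate n).symm k) / P.sideLength k := by
    rw [h5, norm_div, norm_neg, norm_mul, norm_mul, norm_dir hP, norm_dir hP, norm_real, norm_real,
      Real.norm_of_nonneg hl.le, Real.norm_of_nonneg hl'.le, mul_one, mul_one]
  have c1 : (P.sideLength k : ℂ) ≠ 0 := by exact_mod_cast hl.ne'
  have c2 : (P.sideLength ((finRotate n).symm k) : ℂ) ≠ 0 := by exact_mod_cast hl'.ne'
  rw [h6, ← h1, h5] at h2
  push_cast at h2
  field_simp at h2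
  exact h2

/-- The quadrilaterals along the sides of the closed broken line `P` are pairwise disjoint, the
sides are nondegenerate and no left angle is zero (so `leftPoint` and `rightPoint` are not given by
a division by zero). -/
structure HasDisjointQuads (P : Polygon ℂ n) (ε : ℝ) : Prop where
  eps_pos : 0 < ε
  nondegenerate : P.HasNondegenerateEdges
  angle_pos : ∀ k, 0 < P.leftAngle k
  disjoint : ∀ k l, k ≠ l → Disjoint (P.quad ε k) (P.quad ε l)

theorem sin_half_leftAngle_pos (h : 0 < P.leftAngle k) : 0 < Real.sin (P.leftAngle k / 2) :=
  Real.sin_pos_of_pos_of_lt_pi (by linarith) (by linarith [P.leftAngle_lt k])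

theorem mk_bisectorShift_eq (h : 0 < P.leftAngle k) :
    (⟨P.bisectorShift ε k, ε⟩ : ℂ) = ((ε / Real.sin (P.leftAngle k / 2) : ℝ) : ℂ) *
      exp ((P.leftAngle k / 2 : ℝ) * I) := by
  apply Complex.ext
  · rw [re_ofReal_mul, exp_ofReal_mul_I_re, bisectorShift]; ring
  · rw [im_ofReal_mul, exp_ofReal_mul_I_im]
    exact (div_mul_cancel₀ _ (sin_half_leftAngle_pos h).ne').symm

theorem mk_neg_bisectorShift_eq (h : 0 < P.leftAngle k) :
    (⟨-P.bisectorShift ε k, ε⟩ : ℂ) = -(((ε / Real.sin (P.leftAngle k / 2) : ℝ) : ℂ) *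
      exp (-((P.leftAngle k / 2 : ℝ) * I))) := by
  rw [show -((P.leftAngle k / 2 : ℝ) * I) = ((-(P.leftAngle k / 2) : ℝ) : ℂ) * I by
    rw [ofReal_neg, neg_mul]]
  apply Complex.ext
  · rw [neg_re, re_ofReal_mul, exp_ofReal_mul_I_re, bisectorShift, Real.cos_neg]; ring
  · rw [neg_im, im_ofReal_mul, exp_ofReal_mul_I_im, Real.sin_neg, mul_neg, neg_neg]
    exact (div_mul_cancel₀ _ (sin_half_leftAngle_pos h).ne').symm

theorem bisector_eq (h : 0 < P.leftAngle k) :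
    P.bisector ε k = P.dir k * ⟨P.bisectorShift ε k, ε⟩ := by
  rw [mk_bisectorShift_eq h, bisector, dir, mul_comm]

/-- In the frame of the preceding side, the bisecting vector is the mirror image of its coordinates
in the frame of the following side. -/
theorem bisector_eq_of_prev (hP : P.HasNondegenerateEdges) (h : 0 < P.leftAngle k) :
    P.bisector ε k = P.dir ((finRotate n).symm k) * ⟨-P.bisectorShift ε k, ε⟩ := by
  have h1 := exp_leftAngle_mul_dir hP k
  have h2 : exp (P.leftAngle k * I) = exp ((P.leftAngle k / 2 : ℝ) * I) *
      exp ((P.leftAngle k / 2 : ℝ) * I) := by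
    rw [← exp_add]; congr 1; push_cast; ring
  rw [bisector_eq h, mk_neg_bisectorShift_eq h, mul_neg, ← neg_mul, ← h1, h2,
    mk_bisectorShift_eq h, exp_neg]
  have := exp_ne_zero ((P.leftAngle k / 2 : ℝ) * I)
  field_simp

theorem bisector_next (hP : P.HasNondegenerateEdges) (h : 0 < P.leftAngle (finRotate n k)) :
    P.bisector ε (finRotate n k) =
      P.dir k * ⟨-P.bisectorShift ε (finRotate n k), ε⟩ := by
  have := bisector_eq_of_prev (ε := ε) hP h
  rwa [Equiv.symm_apply_apply] at this

end Polygon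

namespace Polygon

variable {n : ℕ} {P : Polygon ℂ n} {ε : ℝ} {k : Fin n}

theorem bisectorForm_eq (h : 0 < P.leftAngle k) (z : ℂ) :
    P.bisectorForm ε k z = P.bisectorShift ε k * (P.coord k z).im - ε * (P.coord k z).re := by
  rw [bisectorForm, bisector_eq h, map_mul, ← mul_assoc, ← coord, mul_im, conj_re, conj_im]
  ring

theorem bisectorForm_next (hP : P.HasNondegenerateEdges) (h : 0 < P.leftAngle (finRotate n k))
    (z : ℂ) : P.bisectorForm ε (finRotate n k) z =
      ε * (P.sideLength k - (P.coord k z).re) -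
        P.bisectorShift ε (finRotate n k) * (P.coord k z).im := by
  have h1 : (z - P (finRotate n k)) * (starRingEnd ℂ) (P.dir k) =
      P.coord k z - P.sideLength k := by
    rw [show z - P (finRotate n k) = z - P k - (P (finRotate n k) - P k) by ring, vertex_sub hP,
      sub_mul, mul_assoc, dir_mul_conj hP, mul_one, coord]
  rw [bisectorForm, bisector_next hP h, map_mul, ← mul_assoc, h1, mul_im, conj_re, conj_im, sub_re,
    sub_im, ofReal_re, ofReal_im]
  ring

theorem coord_sub (P : Polygon ℂ n) (k : Fin n) (z w : ℂ) :
    P.coord k z - P.coord k w = (z - w) * (starRingEnd ℂ) (P.dir k) := by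
  simp only [coord]; ring

theorem continuous_coord (P : Polygon ℂ n) (k : Fin n) : Continuous (P.coord k) := by
  unfold coord; fun_prop

theorem continuous_bisectorForm (P : Polygon ℂ n) (ε : ℝ) (k : Fin n) :
    Continuous (P.bisectorForm ε k) := by
  unfold bisectorForm; fun_prop

@[simp] theorem coord_vertex (P : Polygon ℂ n) (k : Fin n) : P.coord k (P k) = 0 := by
  simp [coord]

theorem coord_next_vertex (hP : P.HasNondegenerateEdges) (k : Fin n) :
    P.coord k (P (finRotate n k)) = P.sideLength k := by
  rw [coord, vertex_sub hP, mul_assoc, dir_mul_conj hP, mul_one]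

theorem rotate_ne (hP : P.HasNondegenerateEdges) (k : Fin n) : finRotate n k ≠ k :=
  fun h => hP k (by rw [h])

theorem coord_add_real_mul_bisector (hP : P.HasNondegenerateEdges) (h : 0 < P.leftAngle k)
    (t : ℝ) : P.coord k (P k + t * P.bisector ε k) = t * ⟨P.bisectorShift ε k, ε⟩ := by
  rw [bisector_eq h, mul_left_comm, coord_add_mul hP]

theorem coord_next_add_real_mul_bisector (hP : P.HasNondegenerateEdges)
    (h : 0 < P.leftAngle (finRotate n k)) (t : ℝ) :
    P.coord k (P (finRotate n k) + t * P.bisector ε (finRotate n k)) =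
      P.sideLength k + t * ⟨-P.bisectorShift ε (finRotate n k), ε⟩ := by
  rw [bisector_next hP h, eq_add_of_sub_eq (vertex_sub hP k), add_comm _ (P k), add_assoc,
    mul_left_comm _ (P.dir k), mul_comm _ (P.dir k), ← mul_add, coord_add_mul hP]

theorem coord_leftPoint (hP : P.HasNondegenerateEdges) (h : 0 < P.leftAngle k) :
    P.coord k (P.leftPoint ε k) = ⟨P.bisectorShift ε k, ε⟩ := by
  simpa [leftPoint] using coord_add_real_mul_bisector (ε := ε) hP h 1

theorem coord_rightPoint (hP : P.HasNondegenerateEdges) (h : 0 < P.leftAngle k) :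
    P.coord k (P.rightPoint ε k) = ⟨-P.bisectorShift ε k, -ε⟩ := by
  have := coord_add_real_mul_bisector (ε := ε) hP h (-1)
  simp only [ofReal_neg, ofReal_one, neg_one_mul, ← sub_eq_add_neg] at this
  rw [rightPoint, this]; rfl

theorem coord_next_leftPoint (hP : P.HasNondegenerateEdges)
    (h : 0 < P.leftAngle (finRotate n k)) :
    P.coord k (P.leftPoint ε (finRotate n k)) =
      ⟨P.sideLength k - P.bisectorShift ε (finRotate n k), ε⟩ := by
  have := coord_next_add_real_mul_bisector (ε := ε) hP h 1
  rw [ofReal_one, one_mul, one_mul] at this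
  rw [leftPoint, this]
  apply Complex.ext <;> simp [sub_eq_add_neg]

theorem coord_next_rightPoint (hP : P.HasNondegenerateEdges)
    (h : 0 < P.leftAngle (finRotate n k)) :
    P.coord k (P.rightPoint ε (finRotate n k)) =
      ⟨P.sideLength k + P.bisectorShift ε (finRotate n k), -ε⟩ := by
  have := coord_next_add_real_mul_bisector (ε := ε) hP h (-1)
  simp only [ofReal_neg, ofReal_one, neg_one_mul, ← sub_eq_add_neg] at this
  rw [rightPoint, this]
  apply Complex.ext <;> simp

/-- The frame at `P k` as a homeomorphism from the coordinates to the plane. -/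
noncomputable def frame (hP : P.HasNondegenerateEdges) (k : Fin n) : ℂ ≃ₜ ℂ where
  toFun w := P k + P.dir k * w
  invFun := P.coord k
  left_inv := coord_add_mul hP k
  right_inv z := (eq_add_coord_mul hP k z).symm
  continuous_toFun := by fun_prop
  continuous_invFun := P.continuous_coord k

/-- The vertices of the quadrilateral along the side `k`. -/
def quadVertices (P : Polygon ℂ n) (ε : ℝ) (k : Fin n) : Set ℂ :=
  {P.leftPoint ε k, P.rightPoint ε k,
    P.leftPoint ε (finRotate n k), P.rightPoint ε (finRotate n k)}

/-- The closed trapezoid that is the convex hull of the vertices of the quadrilateral along the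
side `k`, in the coordinates of this side. It is written with `min` and `max` because the two
vertices on the left (or on the right) may be in the wrong order when `ε` is large. -/
def quadModel (P : Polygon ℂ n) (ε : ℝ) (k : Fin n) : Set ℂ :=
  closedTrapezoid ε
    (min (-P.bisectorShift ε k) (P.sideLength k + P.bisectorShift ε (finRotate n k)))
    (max (-P.bisectorShift ε k) (P.sideLength k + P.bisectorShift ε (finRotate n k)))
    (min (P.bisectorShift ε k) (P.sideLength k - P.bisectorShift ε (finRotate n k)))
    (max (P.bisectorShift ε k) (P.sideLength k - P.bisectorShift ε (finRotate n k)))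

theorem convexHull_quadVertices (hε : 0 < ε) (hP : P.HasNondegenerateEdges)
    (h : ∀ k, 0 < P.leftAngle k) (k : Fin n) :
    convexHull ℝ (P.quadVertices ε k) = frame hP k '' P.quadModel ε k := by
  have h1 : P.quadVertices ε k = frame hP k '' {(⟨P.bisectorShift ε k, ε⟩ : ℂ),
      ⟨-P.bisectorShift ε k, -ε⟩, ⟨P.sideLength k - P.bisectorShift ε (finRotate n k), ε⟩,
      ⟨P.sideLength k + P.bisectorShift ε (finRotate n k), -ε⟩} := by
    simp only [image_insert_eq, image_singleton, ← coord_leftPoint hP (h k),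
      ← coord_rightPoint hP (h k), ← coord_next_leftPoint hP (h _),
      ← coord_next_rightPoint hP (h _)]
    have h2 : ∀ z, frame hP k (P.coord k z) = z := fun z => (frame hP k).right_inv z
    simp only [h2, quadVertices]
  let f : ℂ →ᵃ[ℝ] ℂ := AffineMap.const ℝ ℂ (P k) + (LinearMap.mulLeft ℝ (P.dir k)).toAffineMap
  have hf : ⇑f = frame hP k := by
    funext w
    simp [f, frame]
  rw [h1, ← hf, ← AffineMap.image_convexHull, convexHull_eq_closedTrapezoid_min_max hε, quadModel]

theorem quad_eq (hε : 0 < ε) (hP : P.HasNondegenerateEdges)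
    (h : ∀ k, 0 < P.leftAngle k) (k : Fin n) :
    P.quad ε k = frame hP k '' interior (P.quadModel ε k) := by
  rw [(frame hP k).image_interior, ← convexHull_quadVertices hε hP h]; rfl

theorem mem_frame_image (hP : P.HasNondegenerateEdges) {A : Set ℂ} {z : ℂ} :
    z ∈ frame hP k '' A ↔ P.coord k z ∈ A := by
  rw [(frame hP k).image_eq_preimage_symm]; rfl

theorem midpoint_mem_interior_quadModel (hε : 0 < ε) (hP : P.HasNondegenerateEdges) (k : Fin n) :
    ((P.sideLength k / 2 : ℝ) : ℂ) ∈ interior (P.quadModel ε k) := by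
  have hl := sideLength_pos hP k
  rw [quadModel, mem_interior_closedTrapezoid hε, ofReal_re, ofReal_im]
  simp only [abs_zero, sub_zero, add_zero, hε, true_and, ← mul_add,
    show 2 * ε * (P.sideLength k / 2) = ε * P.sideLength k by ring, mul_lt_mul_iff_right₀ hε]
  generalize P.bisectorShift ε k = a
  generalize P.bisectorShift ε (finRotate n k) = b
  constructor <;>
  rcases le_total (-a) (P.sideLength k + b) with h1 | h1 <;>
  rcases le_total a (P.sideLength k - b) with h2 | h2 <;>
  simp only [h1, h2, min_eq_left, min_eq_right, max_eq_left, max_eq_right] <;> linarith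

theorem quad_nonempty (hε : 0 < ε) (hP : P.HasNondegenerateEdges)
    (h : ∀ k, 0 < P.leftAngle k) (k : Fin n) : (P.quad ε k).Nonempty := by
  rw [quad_eq hε hP h]
  exact ⟨_, mem_image_of_mem _ (midpoint_mem_interior_quadModel hε hP k)⟩

theorem isOpen_quad (P : Polygon ℂ n) (ε : ℝ) (k : Fin n) : IsOpen (P.quad ε k) := isOpen_interior

theorem closure_quad_eq_convexHull (hε : 0 < ε) (hP : P.HasNondegenerateEdges)
    (h : ∀ k, 0 < P.leftAngle k) (k : Fin n) :
    closure (P.quad ε k) = convexHull ℝ (P.quadVertices ε k) := by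
  have hfin : (P.quadVertices ε k).Finite := by simp [quadVertices]
  have hconv := convex_convexHull ℝ (P.quadVertices ε k)
  have := hconv.closure_interior_eq_closure_of_nonempty_interior (quad_nonempty hε hP h k)
  exact this.trans (hfin.isClosed_convexHull ℝ).closure_eq

theorem vertex_mem_segment (P : Polygon ℂ n) (ε : ℝ) (k : Fin n) :
    P k ∈ segment ℝ (P.leftPoint ε k) (P.rightPoint ε k) :=
  ⟨1 / 2, 1 / 2, by norm_num, by norm_num, by norm_num, by
    simp only [leftPoint, rightPoint, real_smul]; push_cast; ring⟩

namespace HasDisjointQuads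

variable (hP : P.HasDisjointQuads ε)
include hP

theorem closure_quad (k : Fin n) :
    closure (P.quad ε k) = convexHull ℝ (P.quadVertices ε k) :=
  closure_quad_eq_convexHull hP.eps_pos hP.nondegenerate hP.angle_pos k

/-- Disjointness improves from the open quadrilaterals to one closed and one open one. -/
theorem eq_of_mem_closure {k l : Fin n} {z : ℂ} (hk : z ∈ closure (P.quad ε k))
    (hl : z ∈ P.quad ε l) : k = l := by
  by_contra hne
  obtain ⟨x, hx⟩ := mem_closure_iff.1 hk _ (P.isOpen_quad ε l) hl
  exact disjoint_left.1 (hP.disjoint k l hne) hx.2 hx.1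

theorem next_vertex_mem_closure (k : Fin n) : P (finRotate n k) ∈ closure (P.quad ε k) := by
  rw [hP.closure_quad]
  exact (convex_convexHull ℝ _).segment_subset (subset_convexHull ℝ _ (by simp [quadVertices]))
    (subset_convexHull ℝ _ (by simp [quadVertices])) (P.vertex_mem_segment ε _)

theorem vertex_notMem_quad (k : Fin n) : P k ∉ P.quad ε k := by
  intro h
  have h1 := hP.next_vertex_mem_closure ((finRotate n).symm k)
  rw [Equiv.apply_symm_apply] at h1
  have := rotate_ne hP.nondegenerate ((finRotate n).symm k)
  rw [Equiv.apply_symm_apply] at this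
  exact this (hP.eq_of_mem_closure h1 h).symm

/-- The disjointness of consecutive quadrilaterals keeps the bisectors at the ends of a side from
crossing before the distance `ε`. -/
theorem shift_add_shift_le (k : Fin n) :
    |P.bisectorShift ε k + P.bisectorShift ε (finRotate n k)| ≤ P.sideLength k := by
  -- otherwise `P k`, a point of the preceding closed quadrilateral, is interior to the convex hull
  have h := hP.vertex_notMem_quad k
  have hε := hP.eps_pos
  have hl := sideLength_pos hP.nondegenerate k
  contrapose! h
  rw [quad_eq hε hP.nondegenerate hP.angle_pos, mem_frame_image, coord_vertex, quadModel,
    mem_interior_closedTrapezoid hε, zero_re, zero_im]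
  simp only [abs_zero, sub_zero, add_zero, hε, true_and, ← mul_add, mul_zero]
  revert h
  generalize P.bisectorShift ε k = a
  generalize P.bisectorShift ε (finRotate n k) = b
  intro h
  rcases lt_abs.1 h with h | h
  · constructor
    · exact mul_neg_of_pos_of_neg hε (by
        linarith [min_le_left (-a) (P.sideLength k + b), min_le_right a (P.sideLength k - b)])
    · exact mul_pos hε (by
        linarith [le_max_right (-a) (P.sideLength k + b), le_max_left a (P.sideLength k - b)])
  · constructor
    · exact mul_neg_of_pos_of_neg hε (by
        linarith [min_le_right (-a) (P.sideLength k + b), min_le_left a (P.sideLength k - b)])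
    · exact mul_pos hε (by
        linarith [le_max_left (-a) (P.sideLength k + b), le_max_right a (P.sideLength k - b)])

theorem quadModel_eq (k : Fin n) : P.quadModel ε k = closedTrapezoid ε (-P.bisectorShift ε k)
    (P.sideLength k + P.bisectorShift ε (finRotate n k)) (P.bisectorShift ε k)
    (P.sideLength k - P.bisectorShift ε (finRotate n k)) := by
  obtain ⟨h1, h2⟩ := abs_le.1 (hP.shift_add_shift_le k)
  rw [quadModel, min_eq_left, min_eq_left, max_eq_right, max_eq_right] <;> linarith

theorem mem_closure_quad {z : ℂ} : z ∈ closure (P.quad ε k) ↔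
    |(P.coord k z).im| ≤ ε ∧ P.bisectorForm ε k z ≤ 0 ∧
      0 ≤ P.bisectorForm ε (finRotate n k) z := by
  rw [hP.closure_quad, convexHull_quadVertices hP.eps_pos hP.nondegenerate hP.angle_pos,
    mem_frame_image, hP.quadModel_eq, bisectorForm_eq (hP.angle_pos k),
    bisectorForm_next hP.nondegenerate (hP.angle_pos _), closedTrapezoid, mem_ofPred_eq]
  refine and_congr Iff.rfl (and_congr ?_ ?_) <;> constructor <;> intro h <;> linarith

theorem mem_quad {z : ℂ} : z ∈ P.quad ε k ↔
    |(P.coord k z).im| < ε ∧ P.bisectorForm ε k z < 0 ∧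
      0 < P.bisectorForm ε (finRotate n k) z := by
  rw [quad_eq hP.eps_pos hP.nondegenerate hP.angle_pos,
    mem_frame_image, hP.quadModel_eq, bisectorForm_eq (hP.angle_pos k),
    bisectorForm_next hP.nondegenerate (hP.angle_pos _), mem_interior_closedTrapezoid hP.eps_pos]
  refine and_congr Iff.rfl (and_congr ?_ ?_) <;> constructor <;> intro h <;> linarith

theorem bisector_ne_zero (k : Fin n) : P.bisector ε k ≠ 0 := by
  rw [bisector_eq (hP.angle_pos k)]
  refine mul_ne_zero (dir_ne_zero hP.nondegenerate k) fun h => hP.eps_pos.ne' ?_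
  simpa using congrArg Complex.im h

theorem exists_eq_add_mul_bisector {z : ℂ} (h : P.bisectorForm ε k z = 0) :
    ∃ t : ℝ, z = P k + t * P.bisector ε k := by
  have hb := hP.bisector_ne_zero k
  refine ⟨((z - P k) / P.bisector ε k).re, ?_⟩
  have h1 : ((z - P k) / P.bisector ε k).im = 0 := by
    have h2 : (z - P k) / P.bisector ε k = (z - P k) * (starRingEnd ℂ) (P.bisector ε k) *
        ((normSq (P.bisector ε k))⁻¹ : ℝ) := by
      rw [div_eq_mul_inv, inv_def, mul_assoc, ofReal_inv]
    rw [h2, im_mul_ofReal, ← bisectorForm, h, zero_mul]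
  have h3 : (((z - P k) / P.bisector ε k).re : ℂ) = (z - P k) / P.bisector ε k :=
    Complex.ext rfl (by rw [ofReal_im, h1])
  rw [h3, div_mul_cancel₀ _ hb, add_sub_cancel]

theorem bisectorForm_pos_of_lt {t : ℝ} (ht : |t| < 1) :
    0 < P.bisectorForm ε (finRotate n k) (P k + t * P.bisector ε k) := by
  have hl := sideLength_pos hP.nondegenerate k
  rw [bisectorForm_next hP.nondegenerate (hP.angle_pos _),
    coord_add_real_mul_bisector hP.nondegenerate (hP.angle_pos k), re_ofReal_mul, im_ofReal_mul]
  have h2 : t * (P.bisectorShift ε k + P.bisectorShift ε (finRotate n k)) < P.sideLength k := by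
    refine (le_abs_self _).trans_lt ?_
    rw [abs_mul]
    exact (mul_le_mul_of_nonneg_left (hP.shift_add_shift_le k) (abs_nonneg t)).trans_lt
      (by nlinarith)
  have := mul_pos hP.eps_pos (sub_pos.2 h2)
  simp only; linarith

theorem bisectorForm_neg_of_lt {t : ℝ} (ht : |t| < 1) :
    P.bisectorForm ε k (P (finRotate n k) + t * P.bisector ε (finRotate n k)) < 0 := by
  have hl := sideLength_pos hP.nondegenerate k
  rw [bisectorForm_eq (hP.angle_pos k),
    coord_next_add_real_mul_bisector hP.nondegenerate (hP.angle_pos _), add_re, add_im,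
    re_ofReal_mul, im_ofReal_mul, ofReal_re, ofReal_im]
  have h2 : t * (P.bisectorShift ε k + P.bisectorShift ε (finRotate n k)) < P.sideLength k := by
    refine (le_abs_self _).trans_lt ?_
    rw [abs_mul]
    exact (mul_le_mul_of_nonneg_left (hP.shift_add_shift_le k) (abs_nonneg t)).trans_lt
      (by nlinarith)
  have := mul_pos hP.eps_pos (sub_pos.2 h2)
  simp only; linarith

/-- Around an interior point of the lateral side on a bisector, the two closed quadrilaterals that
share this side fill a neighbourhood. -/
theorem mem_interior_of_lt {t : ℝ} (ht : |t| < 1) :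
    P (finRotate n k) + t * P.bisector ε (finRotate n k) ∈
      interior (closure (P.quad ε k) ∪ closure (P.quad ε (finRotate n k))) := by
  have hε := hP.eps_pos
  have hlt : |t * ε| < ε := by
    rw [abs_mul, abs_of_pos hε]; nlinarith
  refine mem_interior.2 ⟨{z | |(P.coord k z).im| < ε} ∩ {z | |(P.coord (finRotate n k) z).im| < ε} ∩
    {z | P.bisectorForm ε k z < 0} ∩ {z | 0 < P.bisectorForm ε (finRotate n (finRotate n k)) z},
    ?_, ?_, ⟨⟨?_, ?_⟩, ?_⟩, ?_⟩
  · rintro z ⟨⟨⟨h1, h2⟩, h3⟩, h4⟩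
    rw [mem_union, hP.mem_closure_quad, hP.mem_closure_quad]
    rcases le_total 0 (P.bisectorForm ε (finRotate n k) z) with h | h
    · exact Or.inl ⟨le_of_lt h1, le_of_lt h3, h⟩
    · exact Or.inr ⟨le_of_lt h2, h, le_of_lt h4⟩
  · have c1 := P.continuous_coord k
    have c2 := P.continuous_coord (finRotate n k)
    exact (((isOpen_lt (by fun_prop) continuous_const).inter
      (isOpen_lt (by fun_prop) continuous_const)).inter
      (isOpen_lt (P.continuous_bisectorForm ε k) continuous_const)).inter
      (isOpen_lt continuous_const (P.continuous_bisectorForm ε _))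
  · rw [mem_ofPred_eq, coord_next_add_real_mul_bisector hP.nondegenerate (hP.angle_pos _), add_im,
      im_ofReal_mul, ofReal_im, zero_add]
    exact hlt
  · rw [mem_ofPred_eq, coord_add_real_mul_bisector hP.nondegenerate (hP.angle_pos _),
      im_ofReal_mul]
    exact hlt
  · exact hP.bisectorForm_neg_of_lt ht
  · exact hP.bisectorForm_pos_of_lt ht

theorem vertex_mem_interior (k : Fin n) : P (finRotate n k) ∈
    interior (closure (P.quad ε k) ∪ closure (P.quad ε (finRotate n k))) := by
  simpa using hP.mem_interior_of_lt (k := k) (t := 0) (by simp)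

/-- A point of a side of the polygon lies in the quadrilateral along this side or is one of the two
end points. -/
theorem mem_edgeSet {z : ℂ} (hz : z ∈ P.edgeSet ℝ k) :
    (z ∈ P.quad ε k ∧ (P.coord k z).im = 0) ∨ z = P k ∨ z = P (finRotate n k) := by
  have hε := hP.eps_pos
  have hl := sideLength_pos hP.nondegenerate k
  obtain ⟨t, ⟨ht0, ht1⟩, rfl⟩ := hz
  rcases ht0.eq_or_lt with rfl | ht0
  · right; left; simp
  rcases ht1.eq_or_lt with rfl | ht1
  · right; right; simp
  left
  have hc : P.coord k (AffineMap.lineMap (P k) (P (finRotate n k)) t) =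
      ((t * P.sideLength k : ℝ) : ℂ) := by
    rw [AffineMap.lineMap_apply, vsub_eq_sub, vadd_eq_add, vertex_sub hP.nondegenerate, real_smul,
      add_comm, ← mul_assoc, mul_comm _ (P.dir k), coord_add_mul hP.nondegenerate]
    push_cast; rfl
  rw [hP.mem_quad, bisectorForm_eq (hP.angle_pos k),
    bisectorForm_next hP.nondegenerate (hP.angle_pos _), hc, ofReal_re, ofReal_im]
  refine ⟨⟨by simpa using hε, ?_, ?_⟩, rfl⟩
  · have := mul_pos hε (mul_pos ht0 hl)
    linarith
  · have := mul_pos hε (mul_pos (sub_pos.2 ht1) hl)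
    linarith

end HasDisjointQuads

end Polygon

/-! ### The boundary of an open set without the quadrilaterals -/

theorem IsPreconnected.subset_of_disjoint_frontier {X : Type*} [TopologicalSpace X] {s D : Set X}
    (hs : IsPreconnected s) (hD : IsOpen D) (hne : (s ∩ D).Nonempty)
    (hd : ∀ z ∈ s, z ∉ frontier D) : s ⊆ D :=
  hs.subset_of_closure_inter_subset hD hne fun z hz => by
    by_contra h
    exact hd z hz.2 (by rw [hD.frontier_eq]; exact ⟨hz.1, h⟩)

/-- Let `X` be a closed set such that `X ∩ [a, b]` is relatively open in the segment `[a, b]` except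
at the points of a closed set `V` that contains the end points. Then `X ∩ [a, b]` is made up of
segments with end points in `V`. -/
theorem exists_segment_subset {X V : Set ℂ} (hX : IsClosed X) (hV : IsClosed V) {a b x : ℂ}
    (ha : a ∈ V) (hb : b ∈ V) (hx : x ∈ X) (hxs : x ∈ segment ℝ a b)
    (hloc : ∀ y ∈ X, y ∈ segment ℝ a b → y ∉ V → ∀ᶠ z in 𝓝 y, z ∈ segment ℝ a b → z ∈ X) :
    ∃ c ∈ V ∩ segment ℝ a b, ∃ d ∈ V ∩ segment ℝ a b,
      x ∈ segment ℝ c d ∧ segment ℝ c d ⊆ X := by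
  by_cases hxV : x ∈ V
  · exact ⟨x, ⟨hxV, hxs⟩, x, ⟨hxV, hxs⟩, left_mem_segment ℝ x x, by simpa using hx⟩
  let f : ℝ →ᵃ[ℝ] ℂ := AffineMap.lineMap a b
  have hf : Continuous f := f.continuous_of_finiteDimensional
  have hfs : ∀ t ∈ Icc (0 : ℝ) 1, f t ∈ segment ℝ a b := fun t ht => by
    rw [segment_eq_image_lineMap]; exact mem_image_of_mem _ ht
  rw [segment_eq_image_lineMap] at hxs
  obtain ⟨t, ⟨ht0, ht1⟩, rfl⟩ := hxs
  have hZ : IsClosed (f ⁻¹' V) := hV.preimage hf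
  -- the last parameter before `t` and the first one after `t` with values in `V`
  have hc1 : IsCompact (f ⁻¹' V ∩ Icc 0 t) := isCompact_Icc.inter_left hZ
  have hc2 : IsCompact (f ⁻¹' V ∩ Icc t 1) := isCompact_Icc.inter_left hZ
  obtain ⟨t1, ⟨hV1, h10, h1t⟩, hmax⟩ := hc1.exists_isGreatest
    ⟨0, show f 0 ∈ V by simpa [f] using ha, le_rfl, ht0⟩
  obtain ⟨t2, ⟨hV2, ht2, h21⟩, hmin⟩ := hc2.exists_isLeast
    ⟨1, show f 1 ∈ V by simpa [f] using hb, ht1, le_rfl⟩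
  have hlt1 : t1 < t := h1t.lt_of_ne fun h => hxV (by rw [← h]; exact hV1)
  have hlt2 : t < t2 := ht2.lt_of_ne fun h => hxV (by rw [h]; exact hV2)
  have hnot : ∀ s ∈ Ioo t1 t2, f s ∉ V := by
    intro s hs hsV
    rcases le_total s t with h | h
    · exact (hmax ⟨hsV, h10.trans hs.1.le, h⟩).not_gt hs.1
    · exact (hmin ⟨hsV, h, hs.2.le.trans h21⟩).not_gt hs.2
  have hIoo : Ioo t1 t2 ⊆ f ⁻¹' X := by
    have hopen : IsOpen (Ioo t1 t2 ∩ f ⁻¹' X) := by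
      rw [isOpen_iff_mem_nhds]
      rintro s ⟨hs, hsX⟩
      have hsI : ∀ r ∈ Ioo t1 t2, f r ∈ segment ℝ a b := fun r hr =>
        hfs r ⟨h10.trans hr.1.le, hr.2.le.trans h21⟩
      have h1 := (hf.tendsto s).eventually (hloc (f s) hsX (hsI s hs) (hnot s hs))
      filter_upwards [h1, Ioo_mem_nhds hs.1 hs.2] with r hr hrI
      exact ⟨hrI, hr (hsI r hrI)⟩
    have := isPreconnected_Ioo.subset_of_closure_inter_subset hopen
      ⟨t, ⟨hlt1, hlt2⟩, ⟨hlt1, hlt2⟩, hx⟩ fun s hs =>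
        ⟨hs.2, (hX.preimage hf).closure_subset_iff.2 inter_subset_right hs.1⟩
    exact this.trans inter_subset_right
  have hIcc : Icc t1 t2 ⊆ f ⁻¹' X := by
    rw [← closure_Ioo (hlt1.trans hlt2).ne]
    exact (hX.preimage hf).closure_subset_iff.2 hIoo
  have himg : segment ℝ (f t1) (f t2) = f '' Icc t1 t2 := by
    rw [← segment_eq_Icc (hlt1.trans hlt2).le, image_segment]
  refine ⟨f t1, ⟨hV1, hfs _ ⟨h10, h1t.trans ht1⟩⟩, f t2, ⟨hV2, hfs _ ⟨ht0.trans ht2, h21⟩⟩, ?_, ?_⟩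
  · rw [himg]; exact mem_image_of_mem f ⟨h1t, ht2⟩
  · rw [himg, image_subset_iff]; exact hIcc

namespace Polygon

variable {n : ℕ} {P : Polygon ℂ n} {ε : ℝ} {k : Fin n}

/-- The union of the closed quadrilaterals along the sides. -/
def quadUnion (P : Polygon ℂ n) (ε : ℝ) : Set ℂ := ⋃ k, closure (P.quad ε k)

theorem isClosed_quadUnion (P : Polygon ℂ n) (ε : ℝ) : IsClosed (P.quadUnion ε) :=
  isClosed_iUnion_of_finite fun _ => isClosed_closure

theorem closure_quad_subset (P : Polygon ℂ n) (ε : ℝ) (k : Fin n) :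
    closure (P.quad ε k) ⊆ P.quadUnion ε := subset_iUnion (fun k => closure (P.quad ε k)) k

theorem quad_subset_interior (P : Polygon ℂ n) (ε : ℝ) (k : Fin n) :
    P.quad ε k ⊆ interior (P.quadUnion ε) :=
  (P.isOpen_quad ε k).subset_interior_iff.2 (subset_closure.trans (P.closure_quad_subset ε k))

theorem quadUnion_subset_closure_interior (P : Polygon ℂ n) (ε : ℝ) :
    P.quadUnion ε ⊆ closure (interior (P.quadUnion ε)) :=
  iUnion_subset fun k => closure_mono (P.quad_subset_interior ε k)

theorem finite_bisectingPoints (P : Polygon ℂ n) (ε : ℝ) : (P.bisectingPoints ε).Finite :=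
  (finite_range _).union (finite_range _)

theorem mem_segment_iff_coord (hP : P.HasNondegenerateEdges) {a b z : ℂ} :
    z ∈ segment ℝ a b ↔ P.coord k z ∈ segment ℝ (P.coord k a) (P.coord k b) := by
  have h : ∀ s t : ℝ, s + t = 1 →
      P.coord k (s • a + t • b) = s • P.coord k a + t • P.coord k b := by
    intro s t hst
    obtain rfl : s = 1 - t := by linarith
    simp only [coord, real_smul]; push_cast; ring
  constructor
  · rintro ⟨s, t, hs, ht, hst, rfl⟩
    exact ⟨s, t, hs, ht, hst, (h s t hst).symm⟩
  · rintro ⟨s, t, hs, ht, hst, he⟩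
    refine ⟨s, t, hs, ht, hst, (frame hP k).symm.injective ?_⟩
    exact (h s t hst).trans he

theorem union_subset_interior (P : Polygon ℂ n) (ε : ℝ) (k : Fin n) :
    interior (closure (P.quad ε k) ∪ closure (P.quad ε (finRotate n k))) ⊆
      interior (P.quadUnion ε) :=
  interior_mono (union_subset (P.closure_quad_subset ε _) (P.closure_quad_subset ε _))

theorem mem_bisectingPoints_of_abs_eq_one (P : Polygon ℂ n) (ε : ℝ) {l : Fin n} {t : ℝ}
    (ht : |t| = 1) :
    P l + t * P.bisector ε l ∈ P.bisectingPoints ε := by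
  rcases eq_or_eq_neg_of_abs_eq ht with rfl | rfl
  · exact Or.inl ⟨l, by simp [leftPoint]⟩
  · exact Or.inr ⟨l, by simp [rightPoint, sub_eq_add_neg]⟩

namespace HasDisjointQuads

variable (hP : P.HasDisjointQuads ε)
include hP

theorem boundary_subset_interior : P.boundary ℝ ⊆ interior (P.quadUnion ε) := by
  have hv : ∀ k, P k ∈ interior (P.quadUnion ε) := fun k => by
    have := P.union_subset_interior ε _ (hP.vertex_mem_interior ((finRotate n).symm k))
    rwa [Equiv.apply_symm_apply] at this
  refine iUnion_subset fun k z hz => ?_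
  rcases hP.mem_edgeSet hz with h | rfl | rfl
  · exact P.quad_subset_interior ε k h.1
  · exact hv _
  · exact hv _

theorem one_le_abs_of_notMem_interior {l : Fin n} {t : ℝ}
    (h : P l + t * P.bisector ε l ∉ interior (P.quadUnion ε)) : 1 ≤ |t| := by
  by_contra! ht
  have := P.union_subset_interior ε _
    (hP.mem_interior_of_lt (k := (finRotate n).symm l) ht)
  rw [Equiv.apply_symm_apply] at this
  exact h this

/-- The lateral sides without their end points are interior to the union of the closed
quadrilaterals, which leaves the two sides at the height `ε`. -/
theorem abs_im_coord_eq {z : ℂ} (hz : z ∈ closure (P.quad ε k))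
    (h : z ∉ interior (P.quadUnion ε)) : |(P.coord k z).im| = ε := by
  have hε := hP.eps_pos
  obtain ⟨h1, h2, h3⟩ := hP.mem_closure_quad.1 hz
  by_contra hne
  have hlt := h1.lt_of_ne hne
  refine h (P.quad_subset_interior ε k (hP.mem_quad.2
    ⟨hlt, h2.lt_of_ne fun h0 => ?_, h3.lt_of_ne fun h0 => ?_⟩))
  · obtain ⟨t, rfl⟩ := hP.exists_eq_add_mul_bisector h0
    rw [coord_add_real_mul_bisector hP.nondegenerate (hP.angle_pos k), im_ofReal_mul, abs_mul,
      abs_of_pos hε] at hlt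
    exact hlt.not_ge (le_mul_of_one_le_left hε.le (hP.one_le_abs_of_notMem_interior h))
  · obtain ⟨t, rfl⟩ := hP.exists_eq_add_mul_bisector h0.symm
    rw [coord_next_add_real_mul_bisector hP.nondegenerate (hP.angle_pos _), add_im, im_ofReal_mul,
      ofReal_im, zero_add, abs_mul, abs_of_pos hε] at hlt
    exact hlt.not_ge (le_mul_of_one_le_left hε.le (hP.one_le_abs_of_notMem_interior h))

theorem bisectorForm_neg_and_pos {z : ℂ} (hz : z ∈ closure (P.quad ε k))
    (h : z ∉ interior (P.quadUnion ε)) (hV : z ∉ P.bisectingPoints ε) :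
    P.bisectorForm ε k z < 0 ∧ 0 < P.bisectorForm ε (finRotate n k) z := by
  have hε := hP.eps_pos
  have hle := hP.abs_im_coord_eq hz h
  obtain ⟨-, h2, h3⟩ := hP.mem_closure_quad.1 hz
  refine ⟨h2.lt_of_ne fun h0 => hV ?_, h3.lt_of_ne fun h0 => hV ?_⟩
  · obtain ⟨t, rfl⟩ := hP.exists_eq_add_mul_bisector h0
    rw [coord_add_real_mul_bisector hP.nondegenerate (hP.angle_pos k), im_ofReal_mul, abs_mul,
      abs_of_pos hε] at hle
    exact P.mem_bisectingPoints_of_abs_eq_one ε (mul_right_cancel₀ hε.ne' (by rw [hle, one_mul]))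
  · obtain ⟨t, rfl⟩ := hP.exists_eq_add_mul_bisector h0.symm
    rw [coord_next_add_real_mul_bisector hP.nondegenerate (hP.angle_pos _), add_im, im_ofReal_mul,
      ofReal_im, zero_add, abs_mul, abs_of_pos hε] at hle
    exact P.mem_bisectingPoints_of_abs_eq_one ε (mul_right_cancel₀ hε.ne' (by rw [hle, one_mul]))

/-- A point of the closed quadrilateral at the height `ε` over its side is not on the polygon. -/
theorem notMem_boundary {z : ℂ} (hz : z ∈ closure (P.quad ε k)) (h : |(P.coord k z).im| = ε) :
    z ∉ P.boundary ℝ := by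
  intro hzb
  have hne : (P.coord k z).im ≠ 0 := fun h0 => hP.eps_pos.ne' (by rw [← h, h0, abs_zero])
  have hv : ∀ l, P l ∈ closure (P.quad ε k) → (P.coord k (P l)).im = 0 := by
    intro l hl
    have h1 := hP.vertex_mem_interior ((finRotate n).symm l)
    rw [Equiv.apply_symm_apply] at h1
    obtain ⟨x, hx, hxk⟩ := mem_closure_iff.1 hl _ isOpen_interior h1
    rcases interior_subset hx with hx | hx
    · rw [← hP.eq_of_mem_closure hx hxk]
      have := coord_next_vertex hP.nondegenerate ((finRotate n).symm l)
      rw [Equiv.apply_symm_apply] at this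
      rw [this, ofReal_im]
    · rw [← hP.eq_of_mem_closure hx hxk, coord_vertex, zero_im]
  obtain ⟨l, hl⟩ := mem_iUnion.1 hzb
  rcases hP.mem_edgeSet hl with h1 | rfl | rfl
  · rw [hP.eq_of_mem_closure hz h1.1] at hne
    exact hne h1.2
  · exact hne (hv _ hz)
  · exact hne (hv _ hz)

/-- The points of a closed quadrilateral at the height `ε` form its two sides parallel to the side
of the polygon; the vector `v` points out of the quadrilateral. -/
theorem exists_parallel_side {z : ℂ} (hz : z ∈ closure (P.quad ε k))
    (h : |(P.coord k z).im| = ε) :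
    ∃ a ∈ P.bisectingPoints ε, ∃ b ∈ P.bisectingPoints ε, z ∈ segment ℝ a b ∧
      ∃ v : ℂ, ∀ y ∈ segment ℝ a b, y ∈ closure (P.quad ε k) ∧ |(P.coord k y).im| = ε ∧
        ∀ t : ℝ, 0 < t → y + t * v ∉ closure (P.quad ε k) := by
  have hε := hP.eps_pos
  have hnd := hP.nondegenerate
  obtain ⟨-, h2, h3⟩ := hP.mem_closure_quad.1 hz
  rw [bisectorForm_eq (hP.angle_pos k)] at h2
  rw [bisectorForm_next hnd (hP.angle_pos _)] at h3
  have hcoord : ∀ (y : ℂ) (t σ : ℝ), (P.coord k (y + t * (σ * P.dir k * I))).im =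
      (P.coord k y).im + t * σ := by
    intro y t σ
    have : P.coord k (y + t * (σ * P.dir k * I)) = P.coord k y + ((t * σ : ℝ) : ℂ) * I := by
      have h1 := P.coord_sub k (y + t * (σ * P.dir k * I)) y
      rw [add_sub_cancel_left, show (t : ℂ) * (σ * P.dir k * I) * (starRingEnd ℂ) (P.dir k) =
        t * σ * I * (P.dir k * (starRingEnd ℂ) (P.dir k)) by ring, dir_mul_conj hnd] at h1
      rw [sub_eq_iff_eq_add.1 h1]; push_cast; ring
    rw [this, add_im, im_ofReal_mul, I_im, mul_one]
  have hhull : ∀ a ∈ P.quadVertices ε k, ∀ b ∈ P.quadVertices ε k,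
      segment ℝ a b ⊆ closure (P.quad ε k) := by
    intro a ha b hb
    rw [hP.closure_quad]
    exact (convex_convexHull ℝ _).segment_subset (subset_convexHull ℝ _ ha)
      (subset_convexHull ℝ _ hb)
  have him : ∀ {a b : ℂ} {c : ℝ}, (P.coord k a).im = c → (P.coord k b).im = c →
      ∀ y ∈ segment ℝ a b, (P.coord k y).im = c := by
    intro a b c ha hb y hy
    obtain ⟨s, t, -, -, hst, hy⟩ := (mem_segment_iff_coord hnd (k := k)).1 hy
    rw [← hy, add_im, smul_im, smul_im, ha, hb, smul_eq_mul, smul_eq_mul, ← add_mul, hst, one_mul]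
  have hout : ∀ (σ : ℝ), |σ| = 1 → ∀ y, (P.coord k y).im = σ * ε → ∀ t : ℝ, 0 < t →
      y + t * (σ * P.dir k * I) ∉ closure (P.quad ε k) := by
    intro σ hσ y hy t ht hmem
    have := (hP.mem_closure_quad.1 hmem).1
    rw [hcoord, hy, mul_comm t, ← mul_add, abs_mul, hσ, one_mul, abs_of_pos (by linarith)] at this
    linarith
  rcases eq_or_eq_neg_of_abs_eq h with h | h
  · rw [h] at h2 h3
    refine ⟨P.leftPoint ε k, Or.inl ⟨k, rfl⟩, P.leftPoint ε (finRotate n k), Or.inl ⟨_, rfl⟩, ?_,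
      ((1 : ℝ) : ℂ) * P.dir k * I, fun y hy => ?_⟩
    · rw [mem_segment_iff_coord hnd (k := k), coord_leftPoint hnd (hP.angle_pos k),
        coord_next_leftPoint hnd (hP.angle_pos _)]
      refine mem_segment_of_im_eq h.symm h.symm ?_ ?_
      · exact le_of_mul_le_mul_left (by linarith) hε
      · exact le_of_mul_le_mul_left (a := ε) (by linarith) hε
    · have hy' := him (c := ε) (by rw [coord_leftPoint hnd (hP.angle_pos k)])
        (by rw [coord_next_leftPoint hnd (hP.angle_pos _)]) y hy
      exact ⟨hhull _ (by simp [quadVertices]) _ (by simp [quadVertices]) hy,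
        by rw [hy', abs_of_pos hε], hout 1 abs_one y (by rw [hy', one_mul])⟩
  · rw [h] at h2 h3
    refine ⟨P.rightPoint ε k, Or.inr ⟨k, rfl⟩, P.rightPoint ε (finRotate n k), Or.inr ⟨_, rfl⟩, ?_,
      ((-1 : ℝ) : ℂ) * P.dir k * I, fun y hy => ?_⟩
    · rw [mem_segment_iff_coord hnd (k := k), coord_rightPoint hnd (hP.angle_pos k),
        coord_next_rightPoint hnd (hP.angle_pos _)]
      refine mem_segment_of_im_eq h.symm h.symm ?_ ?_
      · exact le_of_mul_le_mul_left (a := ε) (by linarith) hε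
      · exact le_of_mul_le_mul_left (a := ε) (by linarith) hε
    · have hy' := him (c := -ε) (by rw [coord_rightPoint hnd (hP.angle_pos k)])
        (by rw [coord_next_rightPoint hnd (hP.angle_pos _)]) y hy
      exact ⟨hhull _ (by simp [quadVertices]) _ (by simp [quadVertices]) hy,
        by rw [hy', abs_neg, abs_of_pos hε],
        hout (-1) (by simp) y (by rw [hy', neg_one_mul])⟩

/-- Near a point inside a side that is parallel to the side of the polygon, the quadrilateral is a
half-plane: it contains one of any two points that are symmetric about this point. -/
theorem eventually_mem_or_reflection_mem {y : ℂ} (h : |(P.coord k y).im| = ε)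
    (h1 : P.bisectorForm ε k y < 0) (h2 : 0 < P.bisectorForm ε (finRotate n k) y) :
    ∀ᶠ z in 𝓝 y, z ∈ closure (P.quad ε k) ∨ 2 * y - z ∈ P.quad ε k := by
  have hε := hP.eps_pos
  have hc := P.continuous_coord k
  -- `σ` is the sign of the height of `y` over the side
  obtain ⟨σ, hσ, hy⟩ : ∃ σ : ℝ, |σ| = 1 ∧ σ * (P.coord k y).im = ε := by
    rcases eq_or_eq_neg_of_abs_eq h with h | h
    · exact ⟨1, abs_one, by rw [h, one_mul]⟩
    · exact ⟨-1, by simp, by rw [h]; ring⟩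
  have habs : ∀ x : ℝ, |σ * x| = |x| := fun x => by rw [abs_mul, hσ, one_mul]
  have hev : ∀ᶠ z in 𝓝 y, P.bisectorForm ε k z < 0 ∧ 0 < P.bisectorForm ε (finRotate n k) z ∧
      0 < σ * (P.coord k z).im := by
    refine (((P.continuous_bisectorForm ε k).tendsto y).eventually_lt_const h1).and
      ((((P.continuous_bisectorForm ε _).tendsto y).eventually_const_lt h2).and ?_)
    have : Continuous fun z => σ * (P.coord k z).im := by fun_prop
    exact (this.tendsto y).eventually_const_lt (by rw [hy]; exact hε)
  have hrefl : Filter.Tendsto (fun z => 2 * y - z) (𝓝 y) (𝓝 y) := by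
    have : Continuous fun z : ℂ => 2 * y - z := by fun_prop
    convert this.tendsto y using 2; ring
  filter_upwards [hev, hrefl.eventually hev] with z hz hz'
  rw [hP.mem_closure_quad, hP.mem_quad]
  have hsum : σ * (P.coord k (2 * y - z)).im = 2 * ε - σ * (P.coord k z).im := by
    have : P.coord k (2 * y - z) = 2 * P.coord k y - P.coord k z := by simp only [coord]; ring
    rw [this, sub_im, ← hy]
    simp
    ring
  rcases le_or_gt (σ * (P.coord k z).im) ε with hle | hlt
  · left
    refine ⟨?_, hz.1.le, hz.2.1.le⟩
    rw [← habs, abs_of_pos hz.2.2]; exact hle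
  · right
    refine ⟨?_, hz'.1, hz'.2.1⟩
    rw [← habs, abs_of_pos hz'.2.2, hsum]; linarith

/-- A point where the union of the closed quadrilaterals is not a neighbourhood and which is not one
of the bisecting points lies in just one of them. -/
theorem eq_of_mem_closure_of_mem_closure {l : Fin n} {y : ℂ} (hk : y ∈ closure (P.quad ε k))
    (hl : y ∈ closure (P.quad ε l)) (h : y ∉ interior (P.quadUnion ε))
    (hV : y ∉ P.bisectingPoints ε) : k = l := by
  by_contra hne
  obtain ⟨a1, a2⟩ := hP.bisectorForm_neg_and_pos hk h hV
  obtain ⟨b1, b2⟩ := hP.bisectorForm_neg_and_pos hl h hV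
  refine h (mem_interior_iff_mem_nhds.2 ?_)
  filter_upwards [hP.eventually_mem_or_reflection_mem (hP.abs_im_coord_eq hk h) a1 a2,
    hP.eventually_mem_or_reflection_mem (hP.abs_im_coord_eq hl h) b1 b2] with z hz1 hz2
  rcases hz1 with hz1 | hz1
  · exact P.closure_quad_subset ε k hz1
  rcases hz2 with hz2 | hz2
  · exact P.closure_quad_subset ε l hz2
  exact absurd hz2 (disjoint_left.1 (hP.disjoint k l hne) hz1)

/-- The boundary of an open set that is bounded by the polygon, after removal of the closed
quadrilaterals, consists of segments whose end points are bisecting points in this set. -/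
theorem exists_sides_frontier {D : Set ℂ} (hD : IsOpen D) (hfr : frontier D ⊆ P.boundary ℝ) :
    ∃ E : Set (ℂ × ℂ), E ⊆ (P.bisectingPoints ε ∩ D) ×ˢ (P.bisectingPoints ε ∩ D) ∧
      frontier (D \ P.quadUnion ε) = ⋃ e ∈ E, segment ℝ e.1 e.2 := by
  have hW := P.isClosed_quadUnion ε
  have hT : IsOpen (D \ P.quadUnion ε) := hD.sdiff hW
  have hint : ∀ x ∈ closure (D \ P.quadUnion ε), x ∉ interior (P.quadUnion ε) := by
    intro x hx hxi
    obtain ⟨y, hy⟩ := mem_closure_iff.1 hx _ isOpen_interior hxi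
    exact hy.2.2 (interior_subset hy.1)
  have hXD : ∀ x ∈ frontier (D \ P.quadUnion ε), x ∈ D ∧ x ∈ P.quadUnion ε := by
    intro x hx
    rw [hT.frontier_eq] at hx
    have hxD : x ∈ D := by
      by_contra hxD
      have : x ∈ frontier D := by
        rw [hD.frontier_eq]; exact ⟨closure_mono sdiff_subset hx.1, hxD⟩
      exact hint x hx.1 (hP.boundary_subset_interior (hfr this))
    exact ⟨hxD, by_contra fun h => hx.2 ⟨hxD, h⟩⟩
  refine ⟨{e | e ∈ (P.bisectingPoints ε ∩ D) ×ˢ (P.bisectingPoints ε ∩ D) ∧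
    segment ℝ e.1 e.2 ⊆ frontier (D \ P.quadUnion ε)}, fun e he => he.1, ?_⟩
  refine Subset.antisymm (fun x hx => ?_) (iUnion₂_subset fun e he => he.2)
  obtain ⟨hxD, hxW⟩ := hXD x hx
  obtain ⟨k, hxk⟩ := mem_iUnion.1 hxW
  have hxi := hint x (frontier_subset_closure hx)
  obtain ⟨a, ha, b, hb, hxs, v, hside⟩ := hP.exists_parallel_side hxk (hP.abs_im_coord_eq hxk hxi)
  have hsD : segment ℝ a b ⊆ D :=
    (convex_segment a b).isPreconnected.subset_of_disjoint_frontier hD ⟨x, hxs, hxD⟩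
      fun z hz hzf => hP.notMem_boundary (hside z hz).1 (hside z hz).2.1 (hfr hzf)
  obtain ⟨c, hc, d, hd, hxcd, hcd⟩ := exists_segment_subset isClosed_frontier
    (P.finite_bisectingPoints ε).isClosed ha hb hx hxs (by
      intro y hy hys hyV
      -- near `y` only the quadrilateral along the side `k` has to be removed
      have h1 : ∀ᶠ z in 𝓝 y, z ∈ D ∧ ∀ l, l ≠ k → z ∉ closure (P.quad ε l) := by
        refine (hD.eventually_mem (hsD hys)).and (Filter.eventually_all.2 fun l => ?_)
        by_cases hlk : l = k
        · exact Filter.Eventually.of_forall fun z h => absurd hlk h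
        · have : y ∉ closure (P.quad ε l) := fun hyl =>
            hlk (hP.eq_of_mem_closure_of_mem_closure hyl (hside y hys).1
              (hint y (frontier_subset_closure hy)) hyV)
          filter_upwards [isClosed_closure.isOpen_compl.mem_nhds this] with z hz _ using hz
      filter_upwards [h1.eventually_nhds] with z hz hzs
      rw [hT.frontier_eq]
      refine ⟨?_, fun h => h.2 (P.closure_quad_subset ε k (hside z hzs).1)⟩
      have htend : Filter.Tendsto (fun t : ℝ => z + t * v) (𝓝[>] 0) (𝓝 z) := by
        have : Continuous fun t : ℝ => z + t * v := by fun_prop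
        simpa using (this.tendsto 0).mono_left nhdsWithin_le_nhds
      refine mem_closure_of_tendsto htend ?_
      filter_upwards [htend.eventually hz, self_mem_nhdsWithin] with t ht ht0
      refine ⟨ht.1, fun hmem => ?_⟩
      obtain ⟨l, hl⟩ := mem_iUnion.1 hmem
      by_cases hlk : l = k
      · subst hlk; exact (hside z hzs).2.2 t ht0 hl
      · exact ht.2 l hlk hl)
  exact mem_iUnion₂.2 ⟨(c, d), ⟨⟨⟨hc.1, hsD hc.2⟩, ⟨hd.1, hsD hd.2⟩⟩, hcd⟩, hxcd⟩

end HasDisjointQuads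

end Polygon

open Filter

/-! ### Regions enclosed between inner and outer approximations -/

/-- A bounded region `S` with boundary curve `J`, and open sets `T j ⊆ H j` such that the layers
`H j \ T j`, which are contained in the closed sets `W j`, are nested and converge to `J`. -/
structure IsLayerApproximation (S J : Set ℂ) (T H W : ℕ → Set ℂ) : Prop where
  region : IsBoundedRegion S J
  jordan : IsJordanCurve J
  isOpen_inner : ∀ j, IsOpen (T j)
  isSimplyConnected_inner : ∀ j, IsSimplyConnected (T j)
  isOpen_outer : ∀ j, IsOpen (H j)
  isBounded_outer : ∀ j, Bornology.IsBounded (H j)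
  isSimplyConnected_outer : ∀ j, IsSimplyConnected (H j)
  inner_subset_outer : ∀ j, T j ⊆ H j
  frontier_inner_subset : ∀ j, frontier (T j) ⊆ H j
  isClosed_layer : ∀ j, IsClosed (W j)
  disjoint_layer : ∀ j, Disjoint (T j) (W j)
  diff_subset_layer : ∀ j, closure (H j) \ T j ⊆ W j
  nested : ∀ j, H (j + 1) \ T (j + 1) ⊆ H j \ T j
  inter_nonempty : (⋂ j, T j).Nonempty
  layer_close : ∀ ε : ℝ, 0 < ε → ∀ᶠ j in atTop, ∀ z ∈ W j, ∃ x ∈ J, dist z x < ε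
  close_layer : ∀ ε : ℝ, 0 < ε → ∀ᶠ j in atTop, ∀ x ∈ J, ∃ y ∈ H j \ T j, dist x y < ε

namespace IsLayerApproximation

variable {S J : Set ℂ} {T H W : ℕ → Set ℂ} (h : IsLayerApproximation S J T H W)
include h

/-- `T j` is connected and the boundary of `T (j + 1)` lies in a layer that avoids it. -/
theorem monotone_inner : Monotone T := by
  obtain ⟨z, hz⟩ := h.inter_nonempty
  rw [mem_iInter] at hz
  refine monotone_nat_of_le_succ fun j => ?_
  refine (h.isSimplyConnected_inner j).isPathConnected.isConnected.isPreconnected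
    |>.subset_of_disjoint_frontier (h.isOpen_inner _) ⟨z, hz j, hz (j + 1)⟩ fun x hx hxf => ?_
  have h1 := h.frontier_inner_subset _ hxf
  rw [(h.isOpen_inner _).frontier_eq] at hxf
  exact (h.nested j ⟨h1, hxf.2⟩).2 hx

theorem antitone_outer : Antitone H := by
  refine antitone_nat_of_succ_le fun j => ?_
  have hfr : closure (T (j + 1)) \ T (j + 1) ⊆ H j := by
    rw [← (h.isOpen_inner _).frontier_eq]
    intro x hx
    have h1 := h.frontier_inner_subset _ hx
    rw [(h.isOpen_inner _).frontier_eq] at hx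
    exact (h.nested j ⟨h1, hx.2⟩).1
  -- the part of `T (j + 1)` outside `H j` would be a hole of `H j`
  have hC : (H j)ᶜ ∩ closure (T (j + 1)) = ∅ := by
    refine (h.isSimplyConnected_outer j).compact_hole_eq_empty (h.isOpen_outer j) ?_ ?_ ?_
    · exact isCompact_of_isClosed_isBounded ((h.isOpen_outer j).isClosed_compl.inter
        isClosed_closure) (((h.isBounded_outer _).subset
          (h.inner_subset_outer (j + 1))).closure.subset inter_subset_right)
    · exact disjoint_left.2 fun x hx hx' => hx'.1 hx
    · have : H j ∪ (H j)ᶜ ∩ closure (T (j + 1)) = H j ∪ T (j + 1) := by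
        ext x
        constructor
        · rintro (hx | ⟨hx, hxc⟩)
          · exact Or.inl hx
          · exact Or.inr (by_contra fun hxT => hx (hfr ⟨hxc, hxT⟩))
        · rintro (hx | hx)
          · exact Or.inl hx
          · exact (em (x ∈ H j)).imp id fun hn => ⟨hn, subset_closure hx⟩
      rw [this]
      exact (h.isOpen_outer j).union (h.isOpen_inner _)
  intro x hx
  by_cases hxT : x ∈ T (j + 1)
  · by_contra hn
    exact (hC.subset ⟨hn, subset_closure hxT⟩ : x ∈ (∅ : Set ℂ))
  · exact (h.nested j ⟨hx, hxT⟩).1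

theorem diff_subset (j : ℕ) : H j \ T j ⊆ W j :=
  (sdiff_subset_sdiff_left subset_closure).trans (h.diff_subset_layer j)

theorem curve_subset_layer (j : ℕ) : J ⊆ W j := by
  intro x hx
  rw [← (h.isClosed_layer j).closure_eq, Metric.mem_closure_iff]
  intro ε hε
  obtain ⟨i, hi, hij⟩ := ((h.close_layer ε hε).and (eventually_ge_atTop j)).exists
  obtain ⟨y, hy, hd⟩ := hi x hx
  have hanti : Antitone fun j => H j \ T j := antitone_nat_of_succ_le h.nested
  exact ⟨y, h.diff_subset j (hanti hij hy), hd⟩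

theorem disjoint_inner_curve (j : ℕ) : Disjoint (T j) J :=
  (h.disjoint_layer j).mono_right (h.curve_subset_layer j)

theorem inner_subset_outer' (i j : ℕ) : T i ⊆ H j :=
  (h.monotone_inner (le_max_left i j)).trans
    ((h.inner_subset_outer _).trans (h.antitone_outer (le_max_right i j)))

theorem mem_curve_of_forall_mem_layer {x : ℂ} (hx : ∀ j, x ∈ W j) : x ∈ J := by
  obtain ⟨hJ, -⟩ := h.jordan.exists_inverse
  rw [← hJ.isClosed.closure_eq, Metric.mem_closure_iff]
  intro ε hε
  obtain ⟨j, hj⟩ := (h.layer_close ε hε).exists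
  exact hj x (hx j)

theorem frontier_iUnion_subset : frontier (⋃ j, T j) ⊆ J := by
  intro x hx
  rw [(isOpen_iUnion h.isOpen_inner).frontier_eq] at hx
  refine h.mem_curve_of_forall_mem_layer fun j => h.diff_subset_layer j ⟨?_, fun hxT =>
    hx.2 (mem_iUnion_of_mem j hxT)⟩
  exact closure_mono (iUnion_subset fun i => h.inner_subset_outer' i j) hx.1

/-- The union of the inner sets and `S` are both bounded complementary regions of the Jordan curve,
so they coincide. -/
theorem iUnion_inner_eq : ⋃ j, T j = S := by
  obtain ⟨z, hz⟩ := h.inter_nonempty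
  rw [mem_iInter] at hz
  have ho := isOpen_iUnion h.isOpen_inner
  have hd : Disjoint (⋃ j, T j) J := disjoint_iUnion_left.2 h.disjoint_inner_curve
  have hSd : Disjoint S J := by
    rw [← h.region.frontier_eq, h.region.isOpen.frontier_eq]
    exact disjoint_sdiff_right
  have hne : ¬ Disjoint (⋃ j, T j) S := h.jordan.not_disjoint ho h.region.isOpen
    ((h.isBounded_outer 0).subset (iUnion_subset fun i => h.inner_subset_outer' i 0))
    h.region.isBounded ⟨z, mem_iUnion_of_mem 0 (hz 0)⟩ h.region.isConnected.nonempty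
    h.frontier_iUnion_subset h.region.frontier_eq.subset hd hSd
  obtain ⟨x, hxT, hxS⟩ := not_disjoint_iff.1 hne
  have hpre : IsPreconnected (⋃ j, T j) := isPreconnected_iUnion ⟨z, mem_iInter.2 hz⟩
    fun j => (h.isSimplyConnected_inner j).isPathConnected.isConnected.isPreconnected
  refine Subset.antisymm ?_ ?_
  · exact hpre.subset_of_disjoint_frontier h.region.isOpen ⟨x, hxT, hxS⟩ fun y hy hyf =>
      disjoint_left.1 hd hy (h.region.frontier_eq.subset hyf)
  · exact h.region.isConnected.isPreconnected.subset_of_disjoint_frontier ho ⟨x, hxS, hxT⟩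
      fun y hy hyf => disjoint_left.1 hSd hy (h.frontier_iUnion_subset hyf)

theorem inner_subset (j : ℕ) : T j ⊆ S := by
  rw [← h.iUnion_inner_eq]; exact subset_iUnion T j

theorem subset_outer (j : ℕ) : S ⊆ H j := by
  rw [← h.iUnion_inner_eq]; exact iUnion_subset fun i => h.inner_subset_outer' i j

theorem isSimplyConnected : IsSimplyConnected S := by
  rw [← h.iUnion_inner_eq]
  exact isSimplyConnected_iUnion_of_monotone h.monotone_inner h.isOpen_inner
    h.isSimplyConnected_inner

/-- The outer sets shrink to the closure of `S`. -/
theorem eventually_notMem_outer {e : ℂ} (he : e ∉ closure S) : ∀ᶠ j in atTop, e ∉ H j := by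
  have hJ : e ∉ J := by
    rw [← h.region.frontier_eq]; exact fun hf => he (frontier_subset_closure hf)
  obtain ⟨k, hk⟩ : ∃ k, e ∉ W k := by
    by_contra! hW
    exact hJ (h.mem_curve_of_forall_mem_layer hW)
  refine (eventually_ge_atTop k).mono fun j hj hejH => ?_
  exact hk (h.diff_subset k ⟨h.antitone_outer hj hejH, fun heT =>
    he (subset_closure (h.inner_subset k heT))⟩)

/-- The layers are thin as seen from the boundary of the outer sets. A layer may fold back on itself
and leave points far from this boundary in terms of its width; that this does not persist follows
because exterior points of `S` accumulate at each point of `J`. -/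
theorem exists_forall_subset_inner {ε : ℝ} (hε : 0 < ε) : ∃ k, ∀ j, k ≤ j →
    {z | z ∈ H j ∧ ε ≤ Metric.infDist z (frontier (H j))} ⊆ T j := by
  obtain ⟨hJ, -⟩ := h.jordan.exists_inverse
  -- finitely many points outside the closure of `S` come close to all points of `J`
  have hcover : J ⊆ ⋃ e ∈ (closure S)ᶜ, ball e (ε / 2) := by
    intro x hx
    have := h.jordan.subset_closure_compl_closure h.region.isOpen h.region.isBounded
      h.region.isConnected.nonempty h.region.frontier_eq hx
    obtain ⟨e, he, hd⟩ := Metric.mem_closure_iff.1 this (ε / 2) (by linarith)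
    exact mem_iUnion₂.2 ⟨e, he, hd⟩
  obtain ⟨A, hAS, hAf, hA⟩ := hJ.elim_finite_subcover_image
    (fun e _ => isOpen_ball) hcover
  obtain ⟨k, hk⟩ := eventually_atTop.1 (((eventually_all_finite hAf).2
    fun e he => h.eventually_notMem_outer (hAS he)).and (h.layer_close (ε / 2) (by linarith)))
  refine ⟨k, fun j hj z hz => by_contra fun hzT => ?_⟩
  obtain ⟨hout, hclose⟩ := hk j hj
  obtain ⟨x, hx, hzx⟩ := hclose z (h.diff_subset j ⟨hz.1, hzT⟩)
  obtain ⟨e, he, hxe⟩ := mem_iUnion₂.1 (hA hx)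
  have hze : dist z e < ε := by
    have := dist_triangle z x e
    rw [mem_ball] at hxe
    linarith
  obtain ⟨y, hy, hyf⟩ : (segment ℝ z e ∩ frontier (H j)).Nonempty := by
    by_contra hemp
    refine hout e he ((convex_segment z e).isPreconnected.subset_of_disjoint_frontier
      (h.isOpen_outer j) ⟨z, left_mem_segment ℝ z e, hz.1⟩ (fun y hy hyf => hemp ⟨y, hy, hyf⟩)
      (right_mem_segment ℝ z e))
  have h1 : dist z y ≤ dist z e := by
    have := (convex_closedBall z (dist z e)).segment_subset (mem_closedBall_self dist_nonneg)
      (mem_closedBall'.2 le_rfl) hy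
    exact mem_closedBall'.1 this
  exact absurd hz.2 (not_le.2 (((infDist_le_dist_of_mem hyf).trans h1).trans_lt hze))

end IsLayerApproximation

/-! ### Removing a neighbourhood of the boundary and adding it -/

section Layer

variable {X : Type*} [TopologicalSpace X] {R W : Set X}

theorem frontier_diff_subset (hR : IsOpen R) (hW : IsClosed W) (hfr : frontier R ⊆ interior W) :
    frontier (R \ W) ⊆ R := by
  intro x hx
  rw [(hR.sdiff hW).frontier_eq] at hx
  by_contra hxR
  have : x ∈ interior W := hfr (by rw [hR.frontier_eq]; exact ⟨closure_mono sdiff_subset hx.1, hxR⟩)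
  obtain ⟨y, hy⟩ := _root_.mem_closure_iff.1 hx.1 _ isOpen_interior this
  exact hy.2.2 (interior_subset hy.1)

theorem closure_union_interior_diff_subset (hR : IsOpen R) (hW : IsClosed W)
    (hfr : frontier R ⊆ interior W) : closure (R ∪ interior W) \ (R \ W) ⊆ W := by
  rintro x ⟨hx, hxT⟩
  rw [closure_union] at hx
  rcases hx with hx | hx
  · by_contra hxW
    refine hxW (interior_subset (hfr ?_))
    rw [hR.frontier_eq]
    exact ⟨hx, fun h => hxT ⟨h, hxW⟩⟩
  · exact hW.closure_subset_iff.2 interior_subset hx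

/-- The outer open set has the same boundary as the exterior without the layer. -/
theorem frontier_union_interior (hW : IsClosed W) (hR : IsOpen R) (hfr : frontier R ⊆ interior W)
    (hreg : W ⊆ closure (interior W)) :
    frontier (R ∪ interior W) = frontier ((closure R)ᶜ \ W) := by
  have hH : IsOpen (R ∪ interior W) := hR.union isOpen_interior
  have hE : IsOpen ((closure R)ᶜ \ W) := isClosed_closure.isOpen_compl.sdiff hW
  have hcompl : (R ∪ interior W)ᶜ = closure ((closure R)ᶜ \ W) := by
    apply Subset.antisymm
    · intro x hx
      rw [compl_union] at hx
      have hxR : x ∈ (closure R)ᶜ := fun hxc =>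
        hx.2 (hfr (by rw [hR.frontier_eq]; exact ⟨hxc, hx.1⟩))
      have hxW : x ∈ closure Wᶜ := by rw [closure_compl]; exact hx.2
      exact isClosed_closure.isOpen_compl.inter_closure ⟨hxR, hxW⟩
    · refine hH.isClosed_compl.closure_subset_iff.2 fun x hx hxH => ?_
      rcases hxH with hxR | hxW
      · exact hx.1 (subset_closure hxR)
      · exact hx.2 (interior_subset hxW)
  have hsub : closure ((closure R)ᶜ \ W) \ ((closure R)ᶜ \ W) ⊆ closure (R ∪ interior W) := by
    rintro x ⟨-, hx⟩
    by_cases hxW : x ∈ W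
    · exact closure_mono subset_union_right (hreg hxW)
    · exact closure_mono subset_union_left (by_contra fun hxR => hx ⟨hxR, hxW⟩)
  rw [hH.frontier_eq, hE.frontier_eq]
  apply Subset.antisymm
  · rintro x ⟨hxc, hxH⟩
    refine ⟨hcompl ▸ hxH, fun hxE => ?_⟩
    obtain ⟨y, hyE, hyH⟩ := _root_.mem_closure_iff.1 hxc _ hE hxE
    exact (hcompl.ge (subset_closure hyE)) hyH
  · intro x hx
    exact ⟨hsub hx, hcompl.ge hx.1⟩

end Layer

/-! ### The steps of the generation of a self-similar curve -/

namespace SelfSimilarCurve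

/-- The `j`-fold compositions of the similarities of the curve. -/
def stepMaps (F : SelfSimilarCurve) : ℕ → Set (ℂ → ℂ)
  | 0 => {id}
  | j + 1 => {Φ | ∃ i, ∃ Ψ ∈ F.stepMaps j, Φ = F.map i ∘ Ψ}

/-- The segment between the end points of the generator. -/
def initiator (F : SelfSimilarCurve) : Set ℂ := segment ℝ (F.node 0) (F.node (Fin.last F.m))

variable (F : SelfSimilarCurve)

theorem mem_stepSides {j : ℕ} {s : Set ℂ} :
    s ∈ F.stepSides j ↔ ∃ Φ ∈ F.stepMaps j, s = Φ '' F.initiator := by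
  induction j generalizing s with
  | zero => simp [stepSides, stepMaps, initiator]
  | succ j ih =>
    simp only [stepSides, stepMaps, mem_iUnion, mem_image, mem_ofPred_eq, ih]
    constructor
    · rintro ⟨i, _, ⟨Φ, hΦ, rfl⟩, rfl⟩
      exact ⟨_, ⟨i, Φ, hΦ, rfl⟩, (image_comp ..).symm⟩
    · rintro ⟨_, ⟨i, Φ, hΦ, rfl⟩, rfl⟩
      exact ⟨i, _, ⟨Φ, hΦ, rfl⟩, (image_comp ..).symm⟩

theorem mem_stepNodes {j : ℕ} {x : ℂ} : x ∈ F.stepNodes j ↔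
    ∃ Φ ∈ F.stepMaps j, x = Φ (F.node 0) ∨ x = Φ (F.node (Fin.last F.m)) := by
  induction j generalizing x with
  | zero => simp [stepNodes, stepMaps]
  | succ j ih =>
    simp only [stepNodes, stepMaps, mem_iUnion, mem_image, mem_ofPred_eq, ih]
    constructor
    · rintro ⟨i, _, ⟨Φ, hΦ, rfl | rfl⟩, rfl⟩
      exacts [⟨_, ⟨i, Φ, hΦ, rfl⟩, Or.inl rfl⟩, ⟨_, ⟨i, Φ, hΦ, rfl⟩, Or.inr rfl⟩]
    · rintro ⟨_, ⟨i, Φ, hΦ, rfl⟩, rfl | rfl⟩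
      exacts [⟨i, _, ⟨Φ, hΦ, Or.inl rfl⟩, rfl⟩, ⟨i, _, ⟨Φ, hΦ, Or.inr rfl⟩, rfl⟩]

theorem mem_carrier_iff (j : ℕ) {x : ℂ} :
    x ∈ F.carrier ↔ ∃ Φ ∈ F.stepMaps j, ∃ y ∈ F.carrier, x = Φ y := by
  induction j generalizing x with
  | zero => simp [stepMaps]
  | succ j ih =>
    have hx : x ∈ F.carrier ↔ ∃ i, ∃ z ∈ F.carrier, F.map i z = x := by
      conv_lhs => rw [F.eq_iUnion_map]
      simp only [mem_iUnion, mem_image]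
    rw [hx]
    constructor
    · rintro ⟨i, z, hz, rfl⟩
      obtain ⟨Φ, hΦ, y, hy, rfl⟩ := ih.1 hz
      exact ⟨_, ⟨i, Φ, hΦ, rfl⟩, y, hy, rfl⟩
    · rintro ⟨_, ⟨i, Φ, hΦ, rfl⟩, y, hy, rfl⟩
      exact ⟨i, _, ih.2 ⟨Φ, hΦ, y, hy, rfl⟩, rfl⟩

theorem stepMaps_dist {j : ℕ} {Φ : ℂ → ℂ} (hΦ : Φ ∈ F.stepMaps j) :
    ∃ r : ℝ, 0 < r ∧ ∀ x y, dist (Φ x) (Φ y) = r * dist x y := by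
  induction j generalizing Φ with
  | zero =>
    obtain rfl : Φ = id := hΦ
    exact ⟨1, one_pos, fun x y => (one_mul _).symm⟩
  | succ j ih =>
    obtain ⟨i, Ψ, hΨ, rfl⟩ := hΦ
    obtain ⟨r, hr, h⟩ := ih hΨ
    exact ⟨F.ratio i * r, mul_pos (F.ratio_pos i) hr, fun x y => by
      rw [Function.comp_apply, Function.comp_apply, F.dist_map, h, mul_assoc]⟩

end SelfSimilarCurve

theorem dist_le_of_mem_segment {a b x y : ℂ} (hx : x ∈ segment ℝ a b) (hy : y ∈ segment ℝ a b) :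
    dist x y ≤ dist a b := by
  rw [segment_eq_image_lineMap] at hx hy
  obtain ⟨s, ⟨hs0, hs1⟩, rfl⟩ := hx
  obtain ⟨t, ⟨ht0, ht1⟩, rfl⟩ := hy
  rw [dist_lineMap_lineMap]
  exact mul_le_of_le_one_left dist_nonneg (by rw [Real.dist_eq, abs_le]; constructor <;> linarith)

/-- Only the end points of a segment have the distance of the end points. -/
theorem eq_endpoints_of_dist_eq {a b x y : ℂ} (hx : x ∈ segment ℝ a b) (hy : y ∈ segment ℝ a b)
    (h : dist x y = dist a b) : (x = a ∧ y = b) ∨ (x = b ∧ y = a) := by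
  by_cases hab : a = b
  · subst hab
    rw [segment_same] at hx hy
    exact Or.inl ⟨hx, hy⟩
  rw [segment_eq_image_lineMap] at hx hy
  obtain ⟨s, ⟨hs0, hs1⟩, rfl⟩ := hx
  obtain ⟨t, ⟨ht0, ht1⟩, rfl⟩ := hy
  rw [dist_lineMap_lineMap] at h
  have h1 : |s - t| = 1 := by
    rw [← Real.dist_eq]
    exact mul_right_cancel₀ (dist_ne_zero.2 hab) (by rw [h, one_mul])
  rcases eq_or_eq_neg_of_abs_eq h1 with h1 | h1
  · obtain rfl : s = 1 := by linarith
    obtain rfl : t = 0 := by linarith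
    right; simp
  · obtain rfl : s = 0 := by linarith
    obtain rfl : t = 1 := by linarith
    left; simp

/-- The end points of a segment that is the similar image of another segment. -/
theorem endpoints_of_segment_eq_image {a b c d : ℂ} {Φ : ℂ → ℂ} {r : ℝ} (hr : 0 < r)
    (hΦ : ∀ x y, dist (Φ x) (Φ y) = r * dist x y)
    (h : segment ℝ a b = Φ '' segment ℝ c d) :
    dist a b = r * dist c d ∧ ((Φ c = a ∧ Φ d = b) ∨ (Φ c = b ∧ Φ d = a)) := by
  have hc : Φ c ∈ segment ℝ a b := h ▸ mem_image_of_mem Φ (left_mem_segment ℝ c d)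
  have hd : Φ d ∈ segment ℝ a b := h ▸ mem_image_of_mem Φ (right_mem_segment ℝ c d)
  have hdist : dist a b = r * dist c d := by
    apply le_antisymm
    · obtain ⟨x, hx, hxa⟩ := h.subset (left_mem_segment ℝ a b)
      obtain ⟨y, hy, hyb⟩ := h.subset (right_mem_segment ℝ a b)
      rw [← hxa, ← hyb, hΦ]
      exact mul_le_mul_of_nonneg_left (dist_le_of_mem_segment hx hy) hr.le
    · rw [← hΦ]; exact dist_le_of_mem_segment hc hd
  exact ⟨hdist, eq_endpoints_of_dist_eq hc hd (by rw [hΦ, hdist])⟩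

/-! ### Prefractal polygons under Hypothesis G -/

theorem Real.sin_le_sin_of_mem_Icc_pi_sub {x y : ℝ} (hx : x ∈ Icc (Real.pi - y) y)
    (hy : y ≤ Real.pi) : Real.sin y ≤ Real.sin x := by
  obtain ⟨h1, h2⟩ := hx
  rcases le_total x (Real.pi / 2) with h | h
  · rw [← Real.sin_pi_sub y]
    exact Real.sin_le_sin_of_le_of_le_pi_div_two (by linarith [Real.pi_pos]) h h1
  · rw [← Real.sin_pi_sub y, ← Real.sin_pi_sub x]
    exact Real.sin_le_sin_of_le_of_le_pi_div_two (by linarith [Real.pi_pos]) (by linarith)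
      (by linarith)

namespace HypothesisG

variable {S : Set ℂ} {N : ℕ} {F : Fin N → SelfSimilarCurve} {M : ℕ → ℕ}
  {P : ∀ j, Polygon ℂ (M j)} {R : ℕ → Set ℂ} {ℓ : ℕ → ℝ} {β₀ δ : ℝ}
  (hG : HypothesisG S F P R ℓ β₀ δ)
include hG

theorem length_pos (j : ℕ) : 0 < ℓ j :=
  ((antitone_nat_of_succ_le fun j => (hG.length_lt j).le).le_of_tendsto hG.length_tendsto
    (j + 1)).trans_lt (hG.length_lt j)

theorem eps_pos (j : ℕ) : 0 < δ * ℓ j := mul_pos hG.delta_pos (hG.length_pos j)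

theorem leftAngle_mem (j : ℕ) (k : Fin (M j)) :
    (P j).leftAngle k ∈ Icc (2 * Real.pi - β₀) β₀ := by
  have h : max ((P j).leftAngle k) (2 * Real.pi - (P j).leftAngle k) ≤ β₀ :=
    (le_ciSup (f := fun k => max ((P j).leftAngle k) (2 * Real.pi - (P j).leftAngle k))
      (finite_range _).bddAbove k).trans (hG.maxAngle_le j)
  have h1 := (le_max_left _ _).trans h
  have h2 := (le_max_right _ _).trans h
  exact ⟨by linarith, h1⟩

theorem leftAngle_pos (j : ℕ) (k : Fin (M j)) : 0 < (P j).leftAngle k := by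
  linarith [(hG.leftAngle_mem j k).1, hG.angle_mem.2]

theorem hasDisjointQuads (j : ℕ) : (P j).HasDisjointQuads (δ * ℓ j) where
  eps_pos := hG.eps_pos j
  nondegenerate := (hG.simple j).nondegenerate
  angle_pos := hG.leftAngle_pos j
  disjoint := hG.G1 j

theorem sin_pos : 0 < Real.sin (β₀ / 2) :=
  Real.sin_pos_of_pos_of_lt_pi (by linarith [hG.angle_mem.1, Real.pi_pos])
    (by linarith [hG.angle_mem.2])

/-- The bound on the angles keeps the bisecting points within a multiple of `ℓ j` from the
vertices. -/
theorem norm_bisector_le (j : ℕ) (k : Fin (M j)) :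
    ‖(P j).bisector (δ * ℓ j) k‖ ≤ δ * ℓ j / Real.sin (β₀ / 2) := by
  have hangle := hG.leftAngle_mem j k
  have hs : Real.sin (β₀ / 2) ≤ Real.sin ((P j).leftAngle k / 2) :=
    Real.sin_le_sin_of_mem_Icc_pi_sub ⟨by linarith [hangle.1], by linarith [hangle.2]⟩
      (by linarith [hG.angle_mem.2])
  have hnn := (hG.eps_pos j).le
  have hd := Polygon.norm_dir (hG.simple j).nondegenerate k
  rw [Polygon.dir] at hd
  rw [Polygon.bisector, norm_mul, norm_mul, hd, norm_exp_ofReal_mul_I, norm_real, mul_one, mul_one,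
    Real.norm_of_nonneg (div_nonneg hnn (hG.sin_pos.le.trans hs))]
  exact div_le_div_of_nonneg_left hnn hG.sin_pos hs

theorem dist_vertex_le {j : ℕ} {k : Fin (M j)} {z : ℂ}
    (hz : z ∈ closure ((P j).quad (δ * ℓ j) k)) :
    dist z (P j k) ≤ (1 + δ / Real.sin (β₀ / 2)) * ℓ j := by
  have hb := fun k => hG.norm_bisector_le j k
  have heq : (1 + δ / Real.sin (β₀ / 2)) * ℓ j = ℓ j + δ * ℓ j / Real.sin (β₀ / 2) := by ring
  have hl := hG.side_length j k
  have hlp := hG.length_pos j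
  have hpt : ∀ l (v : ℂ), ‖v‖ = ‖(P j).bisector (δ * ℓ j) l‖ → dist (P j l) (P j k) ≤ ℓ j →
      P j l + v ∈ closedBall (P j k) ((1 + δ / Real.sin (β₀ / 2)) * ℓ j) := by
    intro l v hv hle
    rw [mem_closedBall, heq]
    refine (dist_triangle _ (P j l) _).trans ?_
    rw [dist_eq, add_sub_cancel_left, hv, add_comm]
    exact add_le_add hle (hb l)
  have hl' : dist (P j (finRotate (M j) k)) (P j k) ≤ ℓ j := by rw [dist_comm]; exact hl.le
  rw [(hG.hasDisjointQuads j).closure_quad] at hz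
  refine mem_closedBall.1 (convexHull_min ?_ (convex_closedBall _ _) hz)
  rintro _ (rfl | rfl | rfl | rfl)
  · exact hpt k _ rfl (by rw [dist_self]; exact hlp.le)
  · rw [Polygon.rightPoint, sub_eq_add_neg]
    exact hpt k _ (norm_neg _) (by rw [dist_self]; exact hlp.le)
  · exact hpt _ _ rfl hl'
  · rw [Polygon.rightPoint, sub_eq_add_neg]
    exact hpt _ _ (norm_neg _) hl'

/-- If a side of the polygon is the image of the initiator under a composition of similarities, then
the end points correspond, and the ratio of the composition is determined by the side length. -/
theorem edgeSet_eq (j : ℕ) {k : Fin (M j)} {n : Fin N} {Φ : ℂ → ℂ} (hΦ : Φ ∈ (F n).stepMaps j)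
    (h : (P j).edgeSet ℝ k = Φ '' (F n).initiator) :
    ((Φ ((F n).node 0) = P j k ∧ Φ ((F n).node (Fin.last (F n).m)) = P j (finRotate (M j) k)) ∨
      (Φ ((F n).node 0) = P j (finRotate (M j) k) ∧ Φ ((F n).node (Fin.last (F n).m)) = P j k)) ∧
    0 < dist ((F n).node 0) ((F n).node (Fin.last (F n).m)) ∧
    ∀ x y, dist (Φ x) (Φ y) =
      ℓ j / dist ((F n).node 0) ((F n).node (Fin.last (F n).m)) * dist x y := by
  obtain ⟨r, hr, hd⟩ := (F n).stepMaps_dist hΦ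
  rw [Polygon.edgeSet, affineSegment_eq_segment] at h
  obtain ⟨h1, h2⟩ := endpoints_of_segment_eq_image hr hd h
  rw [hG.side_length] at h1
  have hpos : 0 < dist ((F n).node 0) ((F n).node (Fin.last (F n).m)) := by
    have := hG.length_pos j
    rw [h1] at this
    exact pos_of_mul_pos_right this hr.le
  refine ⟨h2, hpos, fun x y => ?_⟩
  rw [hd, h1, mul_div_cancel_right₀ _ hpos.ne']

theorem range_vertices (j : ℕ) : range (P j).vertices = ⋃ n, (F n).stepNodes j := by
  apply Subset.antisymm
  · rintro _ ⟨k, rfl⟩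
    obtain ⟨n, hn⟩ := mem_iUnion.1 ((hG.sides j).subset (mem_range_self k))
    obtain ⟨Φ, hΦ, he⟩ := (F n).mem_stepSides.1 hn
    refine mem_iUnion.2 ⟨n, (F n).mem_stepNodes.2 ⟨Φ, hΦ, ?_⟩⟩
    rcases (hG.edgeSet_eq j hΦ he).1 with ⟨h1, -⟩ | ⟨-, h1⟩
    · exact Or.inl h1.symm
    · exact Or.inr h1.symm
  · refine iUnion_subset fun n x hx => ?_
    obtain ⟨Φ, hΦ, hx⟩ := (F n).mem_stepNodes.1 hx
    obtain ⟨k, hk⟩ := (hG.sides j).superset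
      (mem_iUnion.2 ⟨n, (F n).mem_stepSides.2 ⟨Φ, hΦ, rfl⟩⟩)
    rcases (hG.edgeSet_eq j hΦ hk).1 with ⟨h1, h2⟩ | ⟨h1, h2⟩ <;> rcases hx with rfl | rfl
    · exact ⟨_, h1.symm⟩
    · exact ⟨_, h2.symm⟩
    · exact ⟨_, h1.symm⟩
    · exact ⟨_, h2.symm⟩

/-- A constant `C` such that in step `j` each side and the corresponding part of the curve are
within the distance `C * ℓ j` of each other. -/
theorem exists_dist_le : ∃ C : ℝ, ∀ j n, ∀ Φ ∈ (F n).stepMaps j, ∀ x ∈ (F n).initiator,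
    ∀ y ∈ (F n).carrier, dist (Φ x) (Φ y) ≤ C * ℓ j := by
  have hD : ∀ n, ∃ D, ∀ x ∈ (F n).initiator, ∀ y ∈ (F n).carrier, dist x y ≤ D := by
    intro n
    have hb : Bornology.IsBounded ((F n).initiator ∪ (F n).carrier) := by
      refine Bornology.IsBounded.union ?_ (F n).isCompact.isBounded
      rw [SelfSimilarCurve.initiator, ← convexHull_pair]
      exact isBounded_convexHull.2 (Set.toFinite _).isBounded
    obtain ⟨D, hD⟩ := isBounded_iff.1 hb
    exact ⟨D, fun x hx y hy => hD (Or.inl hx) (Or.inr hy)⟩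
  choose D hD using hD
  obtain ⟨C, hC⟩ := (finite_range fun n =>
    D n / dist ((F n).node 0) ((F n).node (Fin.last (F n).m))).bddAbove
  refine ⟨C, fun j n Φ hΦ x hx y hy => ?_⟩
  obtain ⟨k, hk⟩ := (hG.sides j).superset
    (mem_iUnion.2 ⟨n, (F n).mem_stepSides.2 ⟨Φ, hΦ, rfl⟩⟩)
  obtain ⟨-, hpos, hdist⟩ := hG.edgeSet_eq j hΦ hk
  have hl := hG.length_pos j
  rw [hdist, div_mul_eq_mul_div, mul_comm, ← div_mul_eq_mul_div]
  refine mul_le_mul_of_nonneg_right (le_trans ?_ (hC (mem_range_self n))) hl.le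
  exact div_le_div_of_nonneg_right (hD n x hx y hy) hpos.le

theorem tendsto_mul_length (C : ℝ) : Tendsto (fun j => C * ℓ j) atTop (𝓝 0) := by
  simpa using hG.length_tendsto.const_mul C

/-- The closed quadrilaterals come uniformly close to the curve. -/
theorem quadUnion_close {ε : ℝ} (hε : 0 < ε) : ∀ᶠ j in atTop,
    ∀ z ∈ (P j).quadUnion (δ * ℓ j), ∃ x ∈ ⋃ n, (F n).carrier, dist z x < ε := by
  obtain ⟨C, hC⟩ := hG.exists_dist_le
  filter_upwards [(hG.tendsto_mul_length (1 + δ / Real.sin (β₀ / 2) + C)).eventually_lt_const hε]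
    with j hj z hz
  obtain ⟨k, hk⟩ := mem_iUnion.1 hz
  obtain ⟨n, hn⟩ := mem_iUnion.1 ((hG.sides j).subset (mem_range_self k))
  obtain ⟨Φ, hΦ, he⟩ := (F n).mem_stepSides.1 hn
  obtain ⟨x, hx, hxk⟩ : P j k ∈ Φ '' (F n).initiator := by
    rw [← he, Polygon.edgeSet, affineSegment_eq_segment]; exact left_mem_segment ..
  obtain ⟨y, hy⟩ := (F n).nonempty
  refine ⟨Φ y, mem_iUnion.2 ⟨n, ((F n).mem_carrier_iff j).2 ⟨Φ, hΦ, y, hy, rfl⟩⟩, ?_⟩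
  have h1 := hG.dist_vertex_le hk
  have h2 := hC j n Φ hΦ x hx y hy
  rw [hxk] at h2
  refine (dist_triangle _ (P j k) _).trans_lt (lt_of_le_of_lt (add_le_add h1 h2) ?_)
  rwa [← add_mul]

/-- The curve comes uniformly close to the prefractal polygons. -/
theorem close_boundary {ε : ℝ} (hε : 0 < ε) : ∀ᶠ j in atTop,
    ∀ x ∈ ⋃ n, (F n).carrier, ∃ y ∈ (P j).boundary ℝ, dist x y < ε := by
  obtain ⟨C, hC⟩ := hG.exists_dist_le
  filter_upwards [(hG.tendsto_mul_length C).eventually_lt_const hε] with j hj x hx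
  obtain ⟨n, hn⟩ := mem_iUnion.1 hx
  obtain ⟨Φ, hΦ, y, hy, rfl⟩ := ((F n).mem_carrier_iff j).1 hn
  obtain ⟨k, hk⟩ := (hG.sides j).superset
    (mem_iUnion.2 ⟨n, (F n).mem_stepSides.2 ⟨Φ, hΦ, rfl⟩⟩)
  have hx0 : (F n).node 0 ∈ (F n).initiator := left_mem_segment ..
  refine ⟨Φ ((F n).node 0), mem_iUnion.2 ⟨k, hk ▸ mem_image_of_mem Φ hx0⟩, ?_⟩
  rw [dist_comm]
  exact (hC j n Φ hΦ _ hx0 y hy).trans_lt hj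

theorem frontier_subset_interior (j : ℕ) :
    frontier (R j) ⊆ interior ((P j).quadUnion (δ * ℓ j)) := by
  rw [(hG.prefractal j).frontier_eq]
  exact (hG.hasDisjointQuads j).boundary_subset_interior

theorem isLayerApproximation : IsLayerApproximation S (⋃ n, (F n).carrier)
    (fun j => (P j).innerPolygon (R j) (δ * ℓ j)) (fun j => (P j).outerPolygon (R j) (δ * ℓ j))
    (fun j => (P j).quadUnion (δ * ℓ j)) where
  region := hG.region
  jordan := hG.jordan
  isOpen_inner j := (hG.prefractal j).isOpen.sdiff ((P j).isClosed_quadUnion _)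
  isSimplyConnected_inner := hG.G2_inner
  isOpen_outer j := (hG.prefractal j).isOpen.union isOpen_interior
  isBounded_outer j := by
    refine (hG.prefractal j).isBounded.union (Bornology.IsBounded.subset ?_ interior_subset)
    refine (Bornology.isBounded_iUnion).2 fun k => ?_
    exact (isBounded_iff_subset_closedBall (P j k)).2
      ⟨_, fun z hz => mem_closedBall.2 (hG.dist_vertex_le hz)⟩
  isSimplyConnected_outer := hG.G2_outer
  inner_subset_outer j := sdiff_subset.trans subset_union_left
  frontier_inner_subset j := (frontier_diff_subset (hG.prefractal j).isOpen
    ((P j).isClosed_quadUnion _) (hG.frontier_subset_interior j)).trans subset_union_left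
  isClosed_layer j := (P j).isClosed_quadUnion _
  disjoint_layer j := disjoint_sdiff_left
  diff_subset_layer j := closure_union_interior_diff_subset (hG.prefractal j).isOpen
    ((P j).isClosed_quadUnion _) (hG.frontier_subset_interior j)
  nested := hG.G3
  inter_nonempty := hG.G4
  layer_close _ hε := hG.quadUnion_close hε
  close_layer _ hε := (hG.close_boundary hε).mono fun j hj x hx => by
    obtain ⟨y, hy, hd⟩ := hj x hx
    have hyi := (hG.hasDisjointQuads j).boundary_subset_interior hy
    exact ⟨y, ⟨Or.inr hyi, fun hyT => hyT.2 (interior_subset hyi)⟩, hd⟩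

theorem isOpenPolygon_inner (j : ℕ) : IsOpenPolygon ((P j).innerPolygon (R j) (δ * ℓ j))
    ((P j).bisectingPoints (δ * ℓ j) ∩ R j) where
  isOpen := hG.isLayerApproximation.isOpen_inner j
  isBounded := (hG.prefractal j).isBounded.subset sdiff_subset
  isSimplyConnected := hG.G2_inner j
  finite := ((P j).finite_bisectingPoints _).subset inter_subset_left
  exists_sides := (hG.hasDisjointQuads j).exists_sides_frontier (hG.prefractal j).isOpen
    (hG.prefractal j).frontier_eq.subset

theorem isOpenPolygon_outer (j : ℕ) : IsOpenPolygon ((P j).outerPolygon (R j) (δ * ℓ j))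
    ((P j).bisectingPoints (δ * ℓ j) \ R j) where
  isOpen := hG.isLayerApproximation.isOpen_outer j
  isBounded := hG.isLayerApproximation.isBounded_outer j
  isSimplyConnected := hG.G2_outer j
  finite := ((P j).finite_bisectingPoints _).subset sdiff_subset
  exists_sides := by
    -- the exterior of `R j` is an open set bounded by the same polygon
    have hfr : frontier (closure (R j))ᶜ ⊆ (P j).boundary ℝ := by
      rw [frontier_compl, ← (hG.prefractal j).frontier_eq]
      exact frontier_closure_subset
    obtain ⟨E, hE, h⟩ := (hG.hasDisjointQuads j).exists_sides_frontier
      (D := (closure (R j))ᶜ) isClosed_closure.isOpen_compl hfr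
    have hsub : (P j).bisectingPoints (δ * ℓ j) ∩ (closure (R j))ᶜ ⊆
        (P j).bisectingPoints (δ * ℓ j) \ R j :=
      fun z hz => ⟨hz.1, fun h => hz.2 (subset_closure h)⟩
    refine ⟨E, hE.trans (prod_mono hsub hsub), ?_⟩
    rw [← h]
    exact frontier_union_interior ((P j).isClosed_quadUnion _) (hG.prefractal j).isOpen
      (hG.frontier_subset_interior j) ((P j).quadUnion_subset_closure_interior _)

end HypothesisG

end

/-- The vertices of `T j` and `H j` are the inner and the outer bisecting points of the corners of
the prefractal polygon `P j`, given by an explicit formula in terms of the vertices of `P j`, which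
are the images of the ends of the initiators under the `j`-fold compositions of the similarities. -/
theorem lemma2p4 (S : Set ℂ) (N : ℕ) (F : Fin N → SelfSimilarCurve)
    (M : ℕ → ℕ) (P : ∀ j, Polygon ℂ (M j)) (R : ℕ → Set ℂ) (ℓ : ℕ → ℝ) (β₀ δ : ℝ)
    (hG : HypothesisG S F P R ℓ β₀ δ) :
    AssumptionA S F
        (fun j => (P j).innerPolygon (R j) (δ * ℓ j))
        (fun j => (P j).outerPolygon (R j) (δ * ℓ j))
        (fun j => (P j).bisectingPoints (δ * ℓ j) ∩ R j)
        (fun j => (P j).bisectingPoints (δ * ℓ j) \ R j) ∧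
      ∀ j, range (P j).vertices = ⋃ n, (F n).stepNodes j := by
  have h := hG.isLayerApproximation
  exact ⟨{
    isOpen := hG.region.isOpen
    isSimplyConnected := h.isSimplyConnected
    inner_polygon := hG.isOpenPolygon_inner
    outer_polygon := hG.isOpenPolygon_outer
    A1 := fun j => ⟨h.monotone_inner j.le_succ, h.inner_subset _, h.subset_outer _,
      h.antitone_outer j.le_succ⟩
    A2 := fun ε hε => h.exists_forall_subset_inner hε
    A3 := hG.region.frontier_eq }, hG.range_vertices⟩
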